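/- **Conventions.** Let $f(x)=-x+\sum_{j\ge2}a_jx^j$ be a real analytic map near the origin. Write $$f(f(x))=x+\sum_{j\ge3}W_j\,x^j ,$$ where $W_j=W_j(a_2,\dots,a_j)$ is a polynomial with rational coefficients in $a_2,\dots,a_j$. For $k\ge3$ a *stability constant of order $k$* is any polynomial $W_k+U\in\mathbb{Q}[a_2,\dots,a_k]$ with $U$ in the ideal $\langle W_3,\dots,W_{k-1}\rangle$ of $\mathbb{Q}[a_2,\dots,a_k]$. The *reduced* stability constant $V_k$ is the normal form of $W_k$ in a Gröbner basis of $\langle W_3,\dots,W_{k-1}\rangle$ for the graded reverse lexicographic order with $a_2>a_3>\cdots>a_k$. The map $f$ is an *involution* if $f(f(x))=x$ near the origin. The origin is *locally asymptotically stable* if it is Lyapunov stable and attracts all points of a neighbourhood, and it is a *repeller* if it has a neighbourhood that is left by the orbit of each of its points other than the origin. **Theorem 2.** Let $f(x)=-x+\sum_{j\ge2}a_jx^j$ be analytic near the origin and not an involution. Then there is $m\ge1$ such that $V_3=V_4=\cdots=V_{2m}=0$ and $V_{2m+1}\ne0$ (values at the coefficients $a_j$ of $f$); thus the first nonzero stability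 constant has odd order. If $V_{2m+1}<0$, the origin is locally asymptotically stable; if $V_{2m+1}>0$, it is a repeller. The same holds, with the same $m$, for any other choice of the stability constants, in particular for the $W_k$. All $V_{2k+1}$, $k\ge1$, are polynomials in $a_2,\dots,a_{2k+1}$, and the first reduced ones are $$ V_{3}=-2a_{2}^2-2a_{3},$$ $$V_{5}=4a_{3}^2-6a_{2} a_{4}-2a_{5},$$ $$V_{7}=3a_{2} a_{3} a_{4}-4a_{4}^2+13a_{3} a_{5}-8a_{2} a_{6}-2a_{7},$$ $$V_{9}=-\tfrac{121}{17}a_{2} a_{4} a_{5}+\tfrac{242}{17}a_{2} a_{3} a_{6}+\tfrac{69}{17}a_{5}^2-10a_{4} a_{6}+\tfrac{358}{17}a_{3} a_{7}-10a_{2} a_{8}-2a_{9},$$ $$V_{11}=-\tfrac{936}{121}a_{3} a_{5}^2+\tfrac{4407}{242}a_{3} a_{4} a_{6}+\tfrac{13}{2}a_{2} a_{5} a_{6}-\tfrac{11765}{242}a_{2} a_{4} a_{7}+\tfrac{4563}{121}a_{2} a_{3} a_{8}-6a_{6}^2+\tfrac{515}{242}a_{5} a_{7}-12a_{4} a_{8}+\tfrac{3865}{121}a_{3}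 a_{9}-12a_{2} a_{10}-2a_{11},$$ $$V_{13}=\tfrac{383791}{109867}a_{4} a_{5} a_{6}+\tfrac{4183988}{1428271}a_{3} a_{6}^2-\tfrac{273943}{329601}a_{4}^2 a_{7}-\tfrac{138885638}{4284813}a_{3} a_{5} a_{7}+\tfrac{1939207}{329601}a_{2} a_{6} a_{7}+\tfrac{145516929}{2856542}a_{3} a_{4} a_{8}+\tfrac{2992379}{219734}a_{2} a_{5} a_{8}-\tfrac{304305945}{2856542}a_{2} a_{4} a_{9}+\tfrac{94587200}{1428271}a_{2} a_{3} a_{10}+\tfrac{3323839}{329601}a_{7}^2-14a_{6} a_{8}-\tfrac{29912981}{2856542}a_{5} a_{9}-14a_{4} a_{10}+\tfrac{62421386}{1428271}a_{3} a_{11}-14a_{2} a_{12}-2a_{13},$$ $$V_{15}=-\tfrac{6188200}{465637}a_{2} a_{3} a_{5} a_{8}+\tfrac{546329272}{115012339}a_{5} a_{6}^2-\tfrac{150876019048}{13916493019}a_{5}^2 a_{7}-\tfrac{4032962292}{1070499463}a_{4} a_{6} a_{7}-\tfrac{10948144126}{1070499463}a_{3} a_{7}^2+\tfrac{2562962080}{115012339}a_{4}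 a_{5} a_{8}+\tfrac{178495020}{8847103}a_{3} a_{6} a_{8}+\tfrac{10885500630}{1070499463}a_{2} a_{7} a_{8}+\tfrac{888498472}{26541309}a_{4}^2 a_{9}-\tfrac{70657783876}{345037017}a_{3} a_{5} a_{9}+\tfrac{102777002}{1396911}a_{2} a_{6} a_{9}+\tfrac{1324158696}{8847103}a_{3} a_{4} a_{10}+\tfrac{2073461406}{115012339}a_{2} a_{5} a_{10}-\tfrac{1932055066}{8847103}a_{2} a_{4} a_{11}+\tfrac{964610838}{8847103}a_{2} a_{3} a_{12}-8a_{8}^2+\tfrac{6893660012}{169026231}a_{7} a_{9}-16a_{6} a_{10}-\tfrac{4393292988}{115012339}a_{5} a_{11}-16a_{4} a_{12}+\tfrac{511907618}{8847103}a_{3} a_{13}-16a_{2} a_{14}-2a_{15}. $$ -/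

import Mathlib

open Filter Topology

noncomputable section

/-! ## The graded reverse lexicographic order -/

/-- Exponent vectors in the variables indexed by `σ`, to be ordered by the graded reverse
lexicographic order with `x_i > x_j` for `i < j`. -/
def GrevlexExp (σ : Type*) := σ →₀ ℕ

namespace GrevlexExp

variable {σ : Type*}

instance : AddCommMonoid (GrevlexExp σ) := inferInstanceAs (AddCommMonoid (σ →₀ ℕ))

/-- The identity, as an additive equivalence. -/
def ofExp : (σ →₀ ℕ) ≃+ GrevlexExp σ := AddEquiv.refl (σ →₀ ℕ)

/-- Total degree first; ties are broken by the reversed colexicographic order. -/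
def key (α : GrevlexExp σ) : ℕ ×ₗ (Colex (σ →₀ ℕ))ᵒᵈ :=
  toLex (Finsupp.degree (ofExp.symm α), OrderDual.toDual (toColex (ofExp.symm α)))

theorem key_injective : Function.Injective (key (σ := σ)) := by
  intro α β h
  have h2 := congrArg (fun x => (ofLex x).2) h
  exact h2

variable [LinearOrder σ]

instance : LinearOrder (GrevlexExp σ) := LinearOrder.lift' key key_injective

theorem lt_iff_key {α β : GrevlexExp σ} : α < β ↔ key α < key β := Iff.rfl

/-- The usual description: the smaller total degree, or, in the case of equal total degrees, the
larger exponent at the last variable where the two exponent vectors differ. -/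
theorem ofExp_lt_iff {α β : σ →₀ ℕ} :
    ofExp α < ofExp β ↔ Finsupp.degree α < Finsupp.degree β ∨
      (Finsupp.degree α = Finsupp.degree β ∧
        ∃ i, (∀ j, i < j → α j = β j) ∧ β i < α i) := by
  rw [lt_iff_key, key, key, Prod.Lex.toLex_lt_toLex]
  refine or_congr Iff.rfl (and_congr Iff.rfl ?_)
  rw [OrderDual.toDual_lt_toDual]
  refine Finsupp.Colex.lt_iff.trans ?_
  refine exists_congr fun i => and_congr ?_ Iff.rfl
  exact forall_congr' fun j => imp_congr Iff.rfl eq_comm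

theorem add_lt_add_left' {α β : σ →₀ ℕ} (h : ofExp α < ofExp β) (γ : σ →₀ ℕ) :
    ofExp (α + γ) < ofExp (β + γ) := by
  rw [ofExp_lt_iff] at h ⊢
  simpa [map_add] using h

instance : IsOrderedAddMonoid (GrevlexExp σ) where
  add_le_add_left α β h γ := by
    rcases h.lt_or_eq with h | h
    · exact (add_lt_add_left' (α := ofExp.symm α) (β := ofExp.symm β) h (ofExp.symm γ)).le
    · rw [h]

theorem ofExp_monotone : Monotone (ofExp : (σ →₀ ℕ) → GrevlexExp σ) := by
  intro α β h
  rcases eq_or_ne α β with rfl | hne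
  · exact le_rfl
  · refine (ofExp_lt_iff.2 (Or.inl ?_)).le
    obtain ⟨γ, rfl⟩ := exists_add_of_le h
    have hγ : γ ≠ 0 := fun h0 => hne (by simp [h0])
    have : Finsupp.degree γ ≠ 0 := fun h0 => hγ ((Finsupp.degree_eq_zero_iff γ).1 h0)
    rw [map_add]
    omega

instance [Finite σ] : WellFoundedLT (GrevlexExp σ) :=
  have : WellQuasiOrderedLE (GrevlexExp σ) :=
    ofExp_monotone.wellQuasiOrderedLE_of_wellQuasiOrderedLE_of_surjective ofExp.surjective
  inferInstance

end GrevlexExp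

/-- The graded reverse lexicographic order in finitely many variables, a smaller index being a
larger variable. -/
def grevlex (σ : Type*) [LinearOrder σ] [Finite σ] : MonomialOrder σ where
  syn := GrevlexExp σ
  toSyn := GrevlexExp.ofExp
  toSyn_monotone := GrevlexExp.ofExp_monotone

/-! ## Gröbner bases and normal forms -/

/-- `G` is a Gröbner basis of the ideal `I` for the monomial order `m`: a finite subset of `I` such
that the leading monomial of every nonzero element of `I` is divisible by the leading monomial of
a nonzero element of `G`. -/
def IsGroebnerBasis {σ K : Type*} [Field K] (m : MonomialOrder σ) (I : Ideal (MvPolynomial σ K))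
    (G : Finset (MvPolynomial σ K)) : Prop :=
  (∀ g ∈ G, g ∈ I) ∧
    ∀ p ∈ I, p ≠ 0 → ∃ g ∈ G, g ≠ 0 ∧ m.degree g ≤ m.degree p

/-- `r` is the normal form of `f` in a Gröbner basis of `I` for the monomial order `m`, i.e. the
remainder of `f` on division by the basis: `f - r ∈ I` and no monomial of `r` is divisible by the
leading monomial of a nonzero element of the basis. (It does not depend on the basis.) -/
def IsNormalForm {σ K : Type*} [Field K] (m : MonomialOrder σ) (I : Ideal (MvPolynomial σ K))
    (f r : MvPolynomial σ K) : Prop :=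
  ∃ G : Finset (MvPolynomial σ K), IsGroebnerBasis m I G ∧ f - r ∈ I ∧
    ∀ α ∈ r.support, ∀ g ∈ G, g ≠ 0 → ¬ m.degree g ≤ α

/-! ## Stability constants -/

/-- The ring `ℚ[a_2, …, a_k]`. -/
abbrev CoeffRing (k : ℕ) : Type := MvPolynomial (Finset.Icc 2 k) ℚ

/-- The variable `a_j` of `ℚ[a_2, …, a_k]` (and `0` if `j` is not one of `2, …, k`). -/
def coeffVar (k j : ℕ) : CoeffRing k :=
  if h : j ∈ Finset.Icc 2 k then MvPolynomial.X ⟨j, h⟩ else 0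

/-- The polynomial `-x + a_2 x^2 + ⋯ + a_k x^k`, as a power series in `x` over
`ℚ[a_2, …, a_k]`. -/
def genericMap (k : ℕ) : PowerSeries (CoeffRing k) :=
  PowerSeries.mk fun j => if j = 1 then -1 else coeffVar k j

/-- For `j ≤ k`, the polynomial `W_j`, i.e. the coefficient of `x ^ j` in `f ∘ f` for
`f = -x + a_2 x^2 + a_3 x^3 + ⋯`, as an element of `ℚ[a_2, …, a_k]`; the terms of degree greater
than `k` of `f` do not contribute to it. -/
def stabPoly (k j : ℕ) : CoeffRing k :=
  PowerSeries.coeff j ((genericMap k).subst (genericMap k))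

/-- The ideal `⟨W_3, …, W_{k-1}⟩` of `ℚ[a_2, …, a_k]`. -/
def stabIdeal (k : ℕ) : Ideal (CoeffRing k) :=
  Ideal.span {p | ∃ j, 3 ≤ j ∧ j < k ∧ p = stabPoly k j}

/-- `V` is an expression of the stability constant of order `k`: `V = W_k + U` with
`U ∈ ⟨W_3, …, W_{k-1}⟩`. -/
def IsStabilityConstant (k : ℕ) (V : CoeffRing k) : Prop :=
  V - stabPoly k k ∈ stabIdeal k

/-- `V` is the reduced stability constant of order `k`: the normal form of `W_k` in a Gröbner
basis of `⟨W_3, …, W_{k-1}⟩` for the graded reverse lexicographic order with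
`a_2 > a_3 > ⋯ > a_k`. -/
def IsReducedStabilityConstant (k : ℕ) (V : CoeffRing k) : Prop :=
  IsNormalForm (grevlex (Finset.Icc 2 k)) (stabIdeal k) (stabPoly k k) V

/-- The value of a polynomial in `a_2, …, a_k` at a real sequence `a`. -/
def evalAt {k : ℕ} (a : ℕ → ℝ) (p : CoeffRing k) : ℝ :=
  MvPolynomial.aeval (fun i : Finset.Icc 2 k => a i) p

/-! ## Dynamics near the fixed point `0` -/

/-- The origin is a locally asymptotically stable fixed point of `f`: it is Lyapunov stable, and
it attracts all points close to it. -/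
def IsLocallyAsymptoticallyStable (f : ℝ → ℝ) : Prop :=
  (∀ ε > 0, ∃ δ > 0, ∀ x : ℝ, |x| < δ → ∀ n : ℕ, |f^[n] x| < ε) ∧
    ∃ δ > 0, ∀ x : ℝ, |x| < δ → Tendsto (fun n : ℕ => f^[n] x) atTop (𝓝 0)

/-- The origin is a repeller of `f`: it has a neighbourhood that is left by the orbit of each of
its points other than the origin. -/
def IsRepeller (f : ℝ → ℝ) : Prop :=
  ∃ U ∈ 𝓝 (0 : ℝ), ∀ x ∈ U, x ≠ 0 → ∃ n : ℕ, f^[n] x ∉ U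

/-! ## The listed formulas -/

/-- The listed formula for the reduced stability constant of order `3`. -/
def explicitV3 {R : Type*} [CommRing R] [Algebra ℚ R] (a : ℕ → R) : R :=
  (-2 : ℚ) • (a 2 ^ 2)
    - (2 : ℚ) • (a 3)

/-- The listed formula for the reduced stability constant of order `5`. -/
def explicitV5 {R : Type*} [CommRing R] [Algebra ℚ R] (a : ℕ → R) : R :=
  (4 : ℚ) • (a 3 ^ 2)
    - (6 : ℚ) • (a 2 * a 4)
    - (2 : ℚ) • (a 5)

/-- The listed formula for the reduced stability constant of order `7`. -/
def explicitV7 {R : Type*} [CommRing R] [Algebra ℚ R] (a : ℕ → R) : R :=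
  (3 : ℚ) • (a 2 * a 3 * a 4)
    - (4 : ℚ) • (a 4 ^ 2)
    + (13 : ℚ) • (a 3 * a 5)
    - (8 : ℚ) • (a 2 * a 6)
    - (2 : ℚ) • (a 7)

/-- The listed formula for the reduced stability constant of order `9`. -/
def explicitV9 {R : Type*} [CommRing R] [Algebra ℚ R] (a : ℕ → R) : R :=
  (-(121 / 17) : ℚ) • (a 2 * a 4 * a 5)
    + (242 / 17 : ℚ) • (a 2 * a 3 * a 6)
    + (69 / 17 : ℚ) • (a 5 ^ 2)
    - (10 : ℚ) • (a 4 * a 6)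
    + (358 / 17 : ℚ) • (a 3 * a 7)
    - (10 : ℚ) • (a 2 * a 8)
    - (2 : ℚ) • (a 9)

/-- The listed formula for the reduced stability constant of order `11`. -/
def explicitV11 {R : Type*} [CommRing R] [Algebra ℚ R] (a : ℕ → R) : R :=
  (-(936 / 121) : ℚ) • (a 3 * a 5 ^ 2)
    + (4407 / 242 : ℚ) • (a 3 * a 4 * a 6)
    + (13 / 2 : ℚ) • (a 2 * a 5 * a 6)
    - (11765 / 242 : ℚ) • (a 2 * a 4 * a 7)
    + (4563 / 121 : ℚ) • (a 2 * a 3 * a 8)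
    - (6 : ℚ) • (a 6 ^ 2)
    + (515 / 242 : ℚ) • (a 5 * a 7)
    - (12 : ℚ) • (a 4 * a 8)
    + (3865 / 121 : ℚ) • (a 3 * a 9)
    - (12 : ℚ) • (a 2 * a 10)
    - (2 : ℚ) • (a 11)

/-- The listed formula for the reduced stability constant of order `13`. -/
def explicitV13 {R : Type*} [CommRing R] [Algebra ℚ R] (a : ℕ → R) : R :=
  (383791 / 109867 : ℚ) • (a 4 * a 5 * a 6)
    + (4183988 / 1428271 : ℚ) • (a 3 * a 6 ^ 2)
    - (273943 / 329601 : ℚ) • (a 4 ^ 2 * a 7)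
    - (138885638 / 4284813 : ℚ) • (a 3 * a 5 * a 7)
    + (1939207 / 329601 : ℚ) • (a 2 * a 6 * a 7)
    + (145516929 / 2856542 : ℚ) • (a 3 * a 4 * a 8)
    + (2992379 / 219734 : ℚ) • (a 2 * a 5 * a 8)
    - (304305945 / 2856542 : ℚ) • (a 2 * a 4 * a 9)
    + (94587200 / 1428271 : ℚ) • (a 2 * a 3 * a 10)
    + (3323839 / 329601 : ℚ) • (a 7 ^ 2)
    - (14 : ℚ) • (a 6 * a 8)
    - (29912981 / 2856542 : ℚ) • (a 5 * a 9)
    - (14 : ℚ) • (a 4 * a 10)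
    + (62421386 / 1428271 : ℚ) • (a 3 * a 11)
    - (14 : ℚ) • (a 2 * a 12)
    - (2 : ℚ) • (a 13)

/-- The listed formula for the reduced stability constant of order `15`. -/
def explicitV15 {R : Type*} [CommRing R] [Algebra ℚ R] (a : ℕ → R) : R :=
  (-(6188200 / 465637) : ℚ) • (a 2 * a 3 * a 5 * a 8)
    + (546329272 / 115012339 : ℚ) • (a 5 * a 6 ^ 2)
    - (150876019048 / 13916493019 : ℚ) • (a 5 ^ 2 * a 7)
    - (4032962292 / 1070499463 : ℚ) • (a 4 * a 6 * a 7)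
    - (10948144126 / 1070499463 : ℚ) • (a 3 * a 7 ^ 2)
    + (2562962080 / 115012339 : ℚ) • (a 4 * a 5 * a 8)
    + (178495020 / 8847103 : ℚ) • (a 3 * a 6 * a 8)
    + (10885500630 / 1070499463 : ℚ) • (a 2 * a 7 * a 8)
    + (888498472 / 26541309 : ℚ) • (a 4 ^ 2 * a 9)
    - (70657783876 / 345037017 : ℚ) • (a 3 * a 5 * a 9)
    + (102777002 / 1396911 : ℚ) • (a 2 * a 6 * a 9)
    + (1324158696 / 8847103 : ℚ) • (a 3 * a 4 * a 10)
    + (2073461406 / 115012339 : ℚ) • (a 2 * a 5 * a 10)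
    - (1932055066 / 8847103 : ℚ) • (a 2 * a 4 * a 11)
    + (964610838 / 8847103 : ℚ) • (a 2 * a 3 * a 12)
    - (8 : ℚ) • (a 8 ^ 2)
    + (6893660012 / 169026231 : ℚ) • (a 7 * a 9)
    - (16 : ℚ) • (a 6 * a 10)
    - (4393292988 / 115012339 : ℚ) • (a 5 * a 11)
    - (16 : ℚ) • (a 4 * a 12)
    + (511907618 / 8847103 : ℚ) • (a 3 * a 13)
    - (16 : ℚ) • (a 2 * a 14)
    - (2 : ℚ) • (a 15)

end

/-!
Write `f ∘ f = x + ∑ W_j x ^ j`. Modulo `W_3, …, W_{n-1}` all stability constants of order `n` are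
equal, so that for a given map the first nonzero one is the first nonzero Taylor coefficient `w` of
`f ∘ f - x`, whichever constants are used. Two facts about it settle the dynamical part.

* Its order `n` is odd (`compCoeff_eq_zero_of_even`): `f` commutes with `g = f ∘ f`, and
  `g x = x + w x ^ n + ⋯`, `f x = -x + ⋯` give `f (g x) = f x - w x ^ n + ⋯` and
  `g (f x) = f x + (-1) ^ n w x ^ n + ⋯`.
* For odd `n` the map `g` moves points by about `|w| |x| ^ n` towards the origin if `w < 0`, and
  away from it if `w > 0` (`stability_of_compCoeff`).

That the formal composite gives the Taylor series of `f ∘ f` is proved by comparing polynomial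
approximations (`HasExpansion.comp_self`). Existence and uniqueness of the reduced constants is the
general theory of Gröbner bases.

The listed formulas are handled in the weight grading, where `a_j` has weight `j - 1` and `W_k` is
homogeneous of weight `k - 1`. Let `I = ⟨W_3, …, W_{k-1}⟩` with `k` odd. For odd `j < k` the
relation `W_j = -2 a_j + ⋯` eliminates `a_j`, so that modulo `I` every polynomial of weight `k - 1` is a
combination of the few monomials in `a_k` and in the `a_j` with `j` even. On the other side, `I`
vanishes at the jets of involutions. With enough explicit such jets, with integral coefficients, the
values at the jets separate these combinations. Consequently two things can be read off from integer
matrices: a polynomial of weight `k - 1` is in `I` if it vanishes at the jets, and a monomial is not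
a leading monomial of `I` if some combination of the jets vanishes at all smaller monomials of the
same weight but not at this one. The theorem `isReducedStabilityConstant_of_isCertificate` turns a
computation of this kind into a proof that a polynomial is the reduced constant; the computations
themselves are Gaussian eliminations over `ℤ`, carried out by the kernel.
-/

/-! ### Formal composition of a map with itself -/

open PowerSeries in
/-- The formal power series `-x + a_2 x ^ 2 + a_3 x ^ 3 + ⋯`. The values `a 0` and `a 1` are
ignored. -/
noncomputable def jet {A : Type*} [CommRing A] (a : ℕ → A) : PowerSeries A :=
  PowerSeries.mk fun j => if j = 0 then 0 else if j = 1 then -1 else a j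

/-- The coefficient of `x ^ j` in `f ∘ f` for the formal power series
`f = -x + a_2 x ^ 2 + a_3 x ^ 3 + ⋯`. -/
noncomputable def compCoeff {A : Type*} [CommRing A] (a : ℕ → A) (j : ℕ) : A :=
  PowerSeries.coeff j ((jet a).subst (jet a))

section Series

open PowerSeries

variable {A B : Type*} [CommRing A] [CommRing B]

theorem coeff_jet (a : ℕ → A) (j : ℕ) :
    coeff j (jet a) = if j = 0 then 0 else if j = 1 then -1 else a j := by
  simp [jet]

theorem coeff_jet_of_two_le (a : ℕ → A) {j : ℕ} (hj : 2 ≤ j) : coeff j (jet a) = a j := by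
  rw [coeff_jet, if_neg (by omega), if_neg (by omega)]

@[simp] theorem coeff_zero_jet (a : ℕ → A) : coeff 0 (jet a) = 0 := by simp [coeff_jet]

@[simp] theorem coeff_one_jet (a : ℕ → A) : coeff 1 (jet a) = -1 := by simp [coeff_jet]

theorem X_dvd_jet (a : ℕ → A) : X ∣ jet a := by
  rw [X_dvd_iff, ← coeff_zero_eq_constantCoeff_apply, coeff_zero_jet]

theorem coeff_jet_pow_of_lt (a : ℕ → A) {i j : ℕ} (h : j < i) : coeff j (jet a ^ i) = 0 :=
  (X_pow_dvd_iff.1 (pow_dvd_pow_of_dvd (X_dvd_jet a) i)) j h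

theorem compCoeff_eq_sum (a : ℕ → A) {j N : ℕ} (h : j < N) :
    compCoeff a j = ∑ i ∈ Finset.range N, coeff i (jet a) * coeff j (jet a ^ i) := by
  have hs : HasSubst (jet a) := HasSubst.of_constantCoeff_zero' (by
    rw [← coeff_zero_eq_constantCoeff_apply, coeff_zero_jet])
  rw [compCoeff, coeff_subst' hs]
  rw [finsum_eq_sum_of_support_subset (s := Finset.range N)]
  · simp only [smul_eq_mul]
  · intro i hi
    simp only [Function.mem_support, smul_eq_mul] at hi
    rw [Finset.coe_range, Set.mem_Iio]
    by_contra hlt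
    exact hi (by rw [coeff_jet_pow_of_lt a (by omega), mul_zero])

theorem map_jet (φ : A →+* B) (a : ℕ → A) : (jet a).map φ = jet fun j => φ (a j) := by
  ext j
  rw [coeff_map, coeff_jet, coeff_jet]
  split_ifs <;> simp

theorem map_compCoeff (φ : A →+* B) (a : ℕ → A) (j : ℕ) :
    φ (compCoeff a j) = compCoeff (fun i => φ (a i)) j := by
  rw [compCoeff_eq_sum a (Nat.lt_succ_self j), compCoeff_eq_sum _ (Nat.lt_succ_self j), map_sum]
  refine Finset.sum_congr rfl fun i _ => ?_
  rw [map_mul, ← map_jet, ← map_pow, coeff_map, coeff_map]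

theorem coeff_pow_congr {F G : PowerSeries A} {j : ℕ} (h : ∀ i ≤ j, coeff i F = coeff i G)
    (n : ℕ) : coeff j (F ^ n) = coeff j (G ^ n) := by
  have h1 : (X : PowerSeries A) ^ (j + 1) ∣ F - G :=
    X_pow_dvd_iff.2 fun i hi => by rw [map_sub, h i (by omega), sub_self]
  have h2 := X_pow_dvd_iff.1 (h1.trans (sub_dvd_pow_sub_pow F G n)) j (Nat.lt_succ_self j)
  rwa [map_sub, sub_eq_zero] at h2

/-- `compCoeff a j` depends only on `a 2, …, a j`. -/
theorem compCoeff_congr {a b : ℕ → A} {j : ℕ} (h : ∀ i, 2 ≤ i → i ≤ j → a i = b i) :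
    compCoeff a j = compCoeff b j := by
  have h' : ∀ i ≤ j, coeff i (jet a) = coeff i (jet b) := by
    intro i hi
    rw [coeff_jet, coeff_jet]
    split_ifs
    · rfl
    · rfl
    · exact h i (by omega) hi
  rw [compCoeff_eq_sum a (Nat.lt_succ_self j), compCoeff_eq_sum b (Nat.lt_succ_self j)]
  refine Finset.sum_congr rfl fun i hi => ?_
  rw [Finset.mem_range] at hi
  rw [h' i (by omega), coeff_pow_congr h']

/-- If `F` has no constant term and its coefficient of `x ^ l` has weight `l - 1`, then the
coefficient of `x ^ n` in `F ^ i` has weight `n - i`. -/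
theorem coeff_pow_mem_of_graded {M : ℕ → AddSubgroup A} (h1 : (1 : A) ∈ M 0)
    (hmul : ∀ u v, ∀ x ∈ M u, ∀ y ∈ M v, x * y ∈ M (u + v))
    {F : PowerSeries A} (hF0 : X ∣ F) {J : ℕ}
    (hF : ∀ l, 1 ≤ l → l < J → coeff l F ∈ M (l - 1)) (i n : ℕ) (hin : i ≤ n)
    (hn : n + 1 < J + i) : coeff n (F ^ i) ∈ M (n - i) := by
  obtain ⟨H, rfl⟩ := hF0
  have key : ∀ i n : ℕ, n + 1 < J → coeff n (H ^ i) ∈ M n := by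
    intro i
    induction i with
    | zero =>
      intro n _
      rw [pow_zero, coeff_one]
      split_ifs with h0
      · rw [h0]; exact h1
      · exact zero_mem _
    | succ i ih =>
      intro n hn
      rw [pow_succ, coeff_mul]
      refine sum_mem fun p hp => ?_
      rw [Finset.HasAntidiagonal.mem_antidiagonal] at hp
      have h2 := hF (p.2 + 1) (by omega) (by omega)
      rw [coeff_succ_X_mul, Nat.add_sub_cancel] at h2
      rw [← hp]
      exact hmul _ _ _ (ih p.1 (by omega)) _ h2
  obtain ⟨m, rfl⟩ := Nat.exists_eq_add_of_le hin
  rw [mul_pow, add_comm i m, coeff_X_pow_mul, Nat.add_sub_cancel]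
  exact key i m (by omega)

/-- Let the elements of `M w` be those of weight `w`. If `a_2, …, a_{J-1}` have weight
`1, …, J - 2`, then `W_J + a_J - (-1) ^ J a_J` has weight `J - 1`. -/
theorem compCoeff_mem_of_graded {M : ℕ → AddSubgroup A} (h1 : (1 : A) ∈ M 0)
    (hmul : ∀ u v, ∀ x ∈ M u, ∀ y ∈ M v, x * y ∈ M (u + v)) (a : ℕ → A) {J : ℕ} (hJ : 2 ≤ J)
    (ha : ∀ l, 2 ≤ l → l < J → a l ∈ M (l - 1)) :
    compCoeff a J + a J - (-1) ^ J * a J ∈ M (J - 1) := by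
  have hF : ∀ l, 1 ≤ l → l < J → coeff l (jet a) ∈ M (l - 1) := by
    intro l hl hlJ
    rcases hl.eq_or_lt with rfl | hl
    · rw [coeff_one_jet]; exact neg_mem h1
    · rw [coeff_jet_of_two_le a hl]; exact ha l hl hlJ
  have hJJ : coeff J (jet a ^ J) = (-1) ^ J := by
    obtain ⟨H, hH⟩ := X_dvd_jet a
    have h2 : constantCoeff H = -1 := by
      rw [← coeff_one_jet a, hH, show (1 : ℕ) = 0 + 1 from rfl, coeff_succ_X_mul,
        coeff_zero_eq_constantCoeff_apply]
    have h3 := coeff_X_pow_mul (H ^ J) J 0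
    rw [zero_add] at h3
    rw [hH, mul_pow, h3, coeff_zero_eq_constantCoeff_apply, map_pow, h2]
  rw [compCoeff_eq_sum a (Nat.lt_succ_self J), Finset.sum_range_succ, hJJ,
    coeff_jet_of_two_le a hJ]
  obtain ⟨m, rfl⟩ := Nat.exists_eq_add_of_le hJ
  rw [show 2 + m = (m + 1) + 1 by ring, Finset.sum_range_succ', Finset.sum_range_succ']
  simp only [zero_add, coeff_zero_jet, coeff_one_jet, zero_mul, pow_one, add_zero]
  rw [coeff_jet_of_two_le a (by omega)]
  have h4 : ∑ i ∈ Finset.range m,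
      coeff (i + 1 + 1) (jet a) * coeff (m + 1 + 1) (jet a ^ (i + 1 + 1)) ∈ M (m + 1 + 1 - 1) := by
    refine sum_mem fun i hi => ?_
    rw [Finset.mem_range] at hi
    have h5 := hmul _ _ _ (hF (i + 1 + 1) (by omega) (by omega)) _
      (coeff_pow_mem_of_graded h1 hmul (X_dvd_jet a) hF (i + 1 + 1) (m + 1 + 1) (by omega)
        (by omega))
    rwa [show i + 1 + 1 - 1 + (m + 1 + 1 - (i + 1 + 1)) = m + 1 + 1 - 1 by omega] at h5
  convert h4 using 1
  ring

theorem compCoeff_add_mem_of_graded_of_odd {M : ℕ → AddSubgroup A} (h1 : (1 : A) ∈ M 0)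
    (hmul : ∀ u v, ∀ x ∈ M u, ∀ y ∈ M v, x * y ∈ M (u + v)) (a : ℕ → A) {J : ℕ} (hJ : 2 ≤ J)
    (hodd : Odd J) (ha : ∀ l, 2 ≤ l → l < J → a l ∈ M (l - 1)) :
    compCoeff a J + (a J + a J) ∈ M (J - 1) := by
  have h := compCoeff_mem_of_graded h1 hmul a hJ ha
  rw [hodd.neg_one_pow] at h
  convert h using 1
  ring

end Series

/-- If `a_2 = ⋯ = a_{J-1} = 0`, then the coefficient of `x ^ J` in `f ∘ f` is
`(-1) ^ J a_J - a_J`. -/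
theorem compCoeff_of_forall_eq_zero {A : Type*} [CommRing A] {a : ℕ → A} {J : ℕ} (hJ : 2 ≤ J)
    (ha : ∀ l, 2 ≤ l → l < J → a l = 0) : compCoeff a J = (-1) ^ J * a J - a J := by
  -- the grading in which everything has weight `0`
  let M : ℕ → AddSubgroup A := fun w => if w = 0 then ⊤ else ⊥
  have hM : ∀ w, w ≠ 0 → M w = ⊥ := fun w hw => if_neg hw
  have h := compCoeff_mem_of_graded (M := M) (by simp [M]) ?_ a hJ ?_
  · rw [hM _ (by omega), AddSubgroup.mem_bot] at h
    linear_combination h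
  · intro u v x hx y hy
    rcases eq_or_ne u 0 with rfl | hu
    · rcases eq_or_ne v 0 with rfl | hv
      · simp [M]
      · rw [hM v hv, AddSubgroup.mem_bot] at hy
        rw [hy, mul_zero]
        exact zero_mem _
    · rw [hM u hu, AddSubgroup.mem_bot] at hx
      rw [hx, zero_mul]
      exact zero_mem _
  · intro l hl hlJ
    rw [ha l hl hlJ]
    exact zero_mem _

theorem compCoeff_zero {A : Type*} [CommRing A] (a : ℕ → A) : compCoeff a 0 = 0 := by
  rw [compCoeff_eq_sum a zero_lt_one, Finset.sum_range_one, coeff_zero_jet, zero_mul]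

theorem compCoeff_one {A : Type*} [CommRing A] (a : ℕ → A) : compCoeff a 1 = 1 := by
  rw [compCoeff_eq_sum a (Nat.lt_succ_self 1), Finset.sum_range_succ, Finset.sum_range_one]; simp

theorem compCoeff_two {A : Type*} [CommRing A] (a : ℕ → A) : compCoeff a 2 = 0 := by
  rw [compCoeff_of_forall_eq_zero le_rfl fun l hl hl' => by omega]; ring

/-! ### Gröbner bases and normal forms -/

section Groebner

open MvPolynomial

open scoped MonomialOrder

variable {σ K : Type*} [Field K] {m : MonomialOrder σ} {I : Ideal (MvPolynomial σ K)}

/-- By Dickson's lemma, the leading monomials of the nonzero elements of an ideal have only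
finitely many minimal ones for divisibility. -/
theorem exists_isGroebnerBasis [Finite σ] (m : MonomialOrder σ) (I : Ideal (MvPolynomial σ K)) :
    ∃ G, IsGroebnerBasis m I G := by
  classical
  set S : Set (σ →₀ ℕ) := {α | ∃ p ∈ I, p ≠ 0 ∧ m.degree p = α} with hS
  have hfin : {α | Minimal (· ∈ S) α}.Finite :=
    WellQuasiOrderedLE.finite_of_isAntichain (setOfPred_minimal_antichain _)
  choose! g hgI hg0 hgdeg using fun α (h : α ∈ S) => h
  refine ⟨hfin.toFinset.image g, ?_, ?_⟩
  · intro q hq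
    obtain ⟨α, hα, rfl⟩ := Finset.mem_image.1 hq
    exact hgI α ((hfin.mem_toFinset.1 hα).prop)
  · intro p hp hp0
    obtain ⟨α, hle, hα⟩ := exists_minimal_le_of_wellFoundedLT (· ∈ S) (m.degree p) ⟨p, hp, hp0, rfl⟩
    refine ⟨g α, Finset.mem_image.2 ⟨α, hfin.mem_toFinset.2 hα, rfl⟩, hg0 α hα.prop, ?_⟩
    rwa [hgdeg α hα.prop]

theorem exists_isNormalForm [Finite σ] (m : MonomialOrder σ) (I : Ideal (MvPolynomial σ K))
    (f : MvPolynomial σ K) : ∃ r, IsNormalForm m I f r := by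
  obtain ⟨G, hG⟩ := exists_isGroebnerBasis m I
  obtain ⟨g, r, hfr, -, hr⟩ := m.div_set (B := {b | b ∈ G ∧ b ≠ 0})
    (fun b hb => (m.leadingCoeff_ne_zero_iff.2 hb.2).isUnit) f
  refine ⟨r, G, hG, ?_, fun α hα b hb hb0 => hr α hα b ⟨hb, hb0⟩⟩
  rw [hfr, add_sub_cancel_right, Finsupp.linearCombination_apply]
  exact Submodule.sum_mem _ fun b _ => I.mul_mem_left _ (hG.1 _ b.2.1)

theorem IsNormalForm.unique {f r s : MvPolynomial σ K} (hr : IsNormalForm m I f r)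
    (hs : IsNormalForm m I f s) : r = s := by
  obtain ⟨G, hG, hrI, hr⟩ := hr
  obtain ⟨H, hH, hsI, hs⟩ := hs
  by_contra hne
  have h0 : r - s ≠ 0 := sub_ne_zero.2 hne
  have hI : r - s ∈ I := by simpa using I.sub_mem hsI hrI
  have hcoeff := (m.coeff_degree_ne_zero_iff).2 h0
  rw [coeff_sub] at hcoeff
  by_cases h : r.coeff (m.degree (r - s)) = 0
  · obtain ⟨g, hg, hg0, hle⟩ := hH.2 _ hI h0
    refine hs _ (mem_support_iff.2 fun h' => hcoeff ?_) g hg hg0 hle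
    rw [h, h', sub_zero]
  · obtain ⟨g, hg, hg0, hle⟩ := hG.2 _ hI h0
    exact hr _ (mem_support_iff.2 h) g hg hg0 hle

/-- A representative of `f` modulo `I` is the normal form of `f` if none of its monomials is the
leading monomial of an element of `I`. -/
theorem isNormalForm_of_forall_coeff_eq_zero [Finite σ] {f r : MvPolynomial σ K}
    (hfr : f - r ∈ I)
    (hr : ∀ α ∈ r.support, ∀ q ∈ I, (∀ β ∈ q.support, β ≼[m] α) → q.coeff α = 0) :
    IsNormalForm m I f r := by
  obtain ⟨G, hG⟩ := exists_isGroebnerBasis m I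
  refine ⟨G, hG, hfr, fun α hα g hg hg0 hle => ?_⟩
  obtain ⟨γ, rfl⟩ := exists_add_of_le hle
  have hq := hr _ hα (g * monomial γ 1) (I.mul_mem_right _ (hG.1 g hg)) fun β hβ => ?_
  · rw [coeff_mul_monomial, mul_one, m.coeff_degree_eq_zero_iff] at hq
    exact hg0 hq
  · refine (m.le_degree hβ).trans ?_
    classical
    rw [m.degree_mul hg0 (by simp), m.degree_monomial, if_neg one_ne_zero]

end Groebner

/-! ### Taylor expansions of composites -/

section Expansion

open PowerSeries Asymptotics

/-- The power series `G` is the Taylor expansion of `g` at the origin: for every `N`, the function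
`g` agrees with the truncation of `G` below degree `N` up to `O(x ^ N)`. -/
def HasExpansion (g : ℝ → ℝ) (G : PowerSeries ℝ) : Prop :=
  ∀ N : ℕ, (fun x => g x - (trunc N G).eval x) =O[𝓝 0] fun x : ℝ => x ^ N

theorem eval_trunc (G : PowerSeries ℝ) (N : ℕ) (x : ℝ) :
    (trunc N G).eval x = ∑ i ∈ Finset.range N, coeff i G * x ^ i := by
  rw [Polynomial.eval, eval₂_trunc_eq_sum_range]
  rfl

theorem isBigO_eval_of_X_pow_dvd {P : Polynomial ℝ} {N : ℕ} (h : Polynomial.X ^ N ∣ P) :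
    (fun x => P.eval x) =O[𝓝 0] fun x : ℝ => x ^ N := by
  obtain ⟨Q, rfl⟩ := h
  have hQ : (fun x => Q.eval x) =O[𝓝 (0 : ℝ)] fun _ => (1 : ℝ) :=
    (Q.continuous.tendsto 0).isBigO_one ℝ
  simpa using (isBigO_refl (fun x : ℝ => x ^ N) (𝓝 0)).mul hQ

theorem hasExpansion_of_hasSum {g : ℝ → ℝ} {G : PowerSeries ℝ}
    (h : ∀ᶠ x in 𝓝 (0 : ℝ), HasSum (fun j : ℕ => coeff j G * x ^ j) (g x)) :
    HasExpansion g G := by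
  have hp : HasFPowerSeriesAt g (FormalMultilinearSeries.ofScalars ℝ fun j => coeff j G) 0 := by
    rw [hasFPowerSeriesAt_iff]
    filter_upwards [h] with x hx
    simpa [FormalMultilinearSeries.coeff_ofScalars, mul_comm] using hx
  intro N
  have h1 := hp.isBigO_sub_partialSum_pow N
  have h2 : (fun x : ℝ => ‖x‖ ^ N) =O[𝓝 0] fun x : ℝ => x ^ N :=
    isBigO_of_le _ fun x => by simp
  refine (h1.trans h2).congr_left fun x => ?_
  rw [zero_add, eval_trunc, FormalMultilinearSeries.partialSum]
  congr 1
  refine Finset.sum_congr rfl fun i _ => ?_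
  rw [FormalMultilinearSeries.ofScalars_apply_eq, smul_eq_mul]

theorem HasExpansion.mul {g h : ℝ → ℝ} {G H : PowerSeries ℝ} (hg : HasExpansion g G)
    (hh : HasExpansion h H) : HasExpansion (fun x => g x * h x) (G * H) := by
  intro N
  have hbd : (fun x => h x) =O[𝓝 (0 : ℝ)] fun _ => (1 : ℝ) := by
    simpa [trunc_zero'] using hh 0
  have hGb : (fun x => (trunc N G).eval x) =O[𝓝 (0 : ℝ)] fun _ => (1 : ℝ) :=
    ((trunc N G).continuous.tendsto 0).isBigO_one ℝ
  have h1 := (hg N).mul hbd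
  have h2 := hGb.mul (hh N)
  have h3 : (fun x => (trunc N G * trunc N H - trunc N (G * H)).eval x)
      =O[𝓝 0] fun x : ℝ => x ^ N := by
    refine isBigO_eval_of_X_pow_dvd (Polynomial.X_pow_dvd_iff.2 fun d hd => ?_)
    rw [Polynomial.coeff_sub, coeff_trunc, if_pos hd,
      coeff_mul_eq_coeff_trunc_mul_trunc G H hd, ← Polynomial.coe_mul, Polynomial.coeff_coe,
      sub_self]
  simp only [mul_one, one_mul] at h1 h2
  refine ((h1.add h2).add h3).congr_left fun x => ?_
  simp only [Polynomial.eval_sub, Polynomial.eval_mul]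
  ring

theorem HasExpansion.pow {g : ℝ → ℝ} {G : PowerSeries ℝ} (hg : HasExpansion g G) (n : ℕ) :
    HasExpansion (fun x => g x ^ n) (G ^ n) := by
  induction n with
  | zero =>
    refine hasExpansion_of_hasSum (Eventually.of_forall fun x => ?_)
    simp only [pow_zero]
    convert hasSum_single (f := fun j : ℕ => coeff j (1 : PowerSeries ℝ) * x ^ j) 0 ?_ using 1
    · simp
    · intro j hj
      simp [coeff_one, hj]
  | succ n ih => simpa only [pow_succ] using ih.mul hg

theorem HasExpansion.isBigO {g : ℝ → ℝ} {G : PowerSeries ℝ} (hg : HasExpansion g G) {n : ℕ}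
    (hG : ∀ i < n, coeff i G = 0) : g =O[𝓝 0] fun x : ℝ => x ^ n := by
  refine (hg n).congr_left fun x => ?_
  rw [eval_trunc, Finset.sum_eq_zero, sub_zero]
  intro i hi
  rw [hG i (Finset.mem_range.1 hi), zero_mul]

/-- A function has at most one Taylor expansion. -/
theorem HasExpansion.unique {g : ℝ → ℝ} {G H : PowerSeries ℝ} (hG : HasExpansion g G)
    (hH : HasExpansion g H) : G = H := by
  ext n
  induction n using Nat.strong_induction_on with
  | _ n ih =>
    have h1 : (fun x : ℝ => (coeff n G - coeff n H) * x ^ n) =O[𝓝 0] fun x : ℝ => x ^ (n + 1) := by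
      refine ((hH (n + 1)).sub (hG (n + 1))).congr_left fun x => ?_
      rw [eval_trunc, eval_trunc, Finset.sum_range_succ, Finset.sum_range_succ,
        Finset.sum_congr rfl fun i hi => congrArg (· * x ^ i) (ih i (Finset.mem_range.1 hi)).symm]
      ring
    have h2 : (fun x : ℝ => (coeff n G - coeff n H) * x ^ n) =o[𝓝 0] fun x : ℝ => x ^ n :=
      h1.trans_isLittleO (isLittleO_pow_pow (Nat.lt_succ_self n))
    by_contra hne
    have h3 : (fun x : ℝ => x ^ n) =o[𝓝 0] fun x : ℝ => x ^ n :=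
      ((isLittleO_const_mul_left_iff (sub_ne_zero.2 hne)).1 h2)
    have h4 : ∀ᶠ x in 𝓝[≠] (0 : ℝ), x ^ n ≠ 0 :=
      eventually_mem_nhdsWithin.mono fun x hx => pow_ne_zero n hx
    exact isLittleO_irrefl h4.frequently (h3.mono nhdsWithin_le_nhds)

theorem HasExpansion.tendsto {g : ℝ → ℝ} {G : PowerSeries ℝ} (hg : HasExpansion g G)
    (h0 : coeff 0 G = 0) : Tendsto g (𝓝 0) (𝓝 0) := by
  have h := hg.isBigO (n := 1) fun i hi => by rwa [Nat.lt_one_iff.1 hi]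
  refine h.trans_tendsto ?_
  simpa using (continuous_pow 1).tendsto (0 : ℝ)

/-- The Taylor expansion of `f ∘ f` is the formal composite. -/
theorem HasExpansion.comp_self {f : ℝ → ℝ} {a : ℕ → ℝ} (hf : HasExpansion f (jet a)) :
    HasExpansion (fun x => f (f x)) (PowerSeries.mk (compCoeff a)) := by
  intro N
  have hO : f =O[𝓝 0] fun x : ℝ => x ^ 1 :=
    hf.isBigO fun i hi => by rw [Nat.lt_one_iff.1 hi, coeff_zero_jet]
  simp only [pow_one] at hO
  have h1 : (fun x => f (f x) - (trunc N (jet a)).eval (f x)) =O[𝓝 0] fun x : ℝ => x ^ N :=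
    ((hf N).comp_tendsto (hf.tendsto (coeff_zero_jet a))).trans (hO.pow N)
  have h2 : (fun x => ∑ i ∈ Finset.range N, coeff i (jet a) *
      (f x ^ i - (trunc N (jet a ^ i)).eval x)) =O[𝓝 0] fun x : ℝ => x ^ N :=
    IsBigO.fun_sum fun i _ => (hf.pow i N).const_mul_left _
  refine (h1.add h2).congr_left fun x => ?_
  have h3 : ∑ i ∈ Finset.range N, coeff i (jet a) * (trunc N (jet a ^ i)).eval x
      = (trunc N (PowerSeries.mk (compCoeff a))).eval x := by
    simp only [eval_trunc, Finset.mul_sum]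
    rw [Finset.sum_comm]
    refine Finset.sum_congr rfl fun j hj => ?_
    rw [coeff_mk, compCoeff_eq_sum a (Finset.mem_range.1 hj), Finset.sum_mul]
    exact Finset.sum_congr rfl fun i _ => by ring
  rw [← h3, eval_trunc]
  simp only [mul_sub, Finset.sum_sub_distrib]
  ring

end Expansion

section Analytic

open Asymptotics

variable {f : ℝ → ℝ} {a : ℕ → ℝ}

theorem hasSum_jet
    (hf : ∀ᶠ x in 𝓝 (0 : ℝ), HasSum (fun j : ℕ => a (j + 2) * x ^ (j + 2)) (f x + x)) :
    ∀ᶠ x in 𝓝 (0 : ℝ), HasSum (fun j : ℕ => PowerSeries.coeff j (jet a) * x ^ j) (f x) := by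
  filter_upwards [hf] with x hx
  rw [← hasSum_nat_add_iff' 2]
  simp only [Finset.sum_range_succ, Finset.sum_range_zero, coeff_zero_jet, coeff_one_jet]
  have h1 : ∀ j, PowerSeries.coeff (j + 2) (jet a) = a (j + 2) := fun j =>
    coeff_jet_of_two_le a (by omega)
  simp only [h1]
  rwa [show f x - (0 + 0 * x ^ 0 + -1 * x ^ 1) = f x + x by ring]

theorem analyticAt_of_hasSum
    (hf : ∀ᶠ x in 𝓝 (0 : ℝ), HasSum (fun j : ℕ => a (j + 2) * x ^ (j + 2)) (f x + x)) :
    AnalyticAt ℝ f 0 := by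
  refine ⟨FormalMultilinearSeries.ofScalars ℝ fun j => PowerSeries.coeff j (jet a), ?_⟩
  rw [hasFPowerSeriesAt_iff]
  filter_upwards [hasSum_jet hf] with x hx
  simpa [FormalMultilinearSeries.coeff_ofScalars, mul_comm] using hx

theorem apply_zero_of_hasExpansion (h : HasExpansion f (jet a)) : f 0 = 0 := by
  have h1 := (h.isBigO (n := 1) fun i hi => by rw [Nat.lt_one_iff.1 hi, coeff_zero_jet])
  exact (h1.eq_zero_imp.self_of_nhds) (by simp)

/-- The coefficients of the formal composite are those of the Taylor series of `f ∘ f`. -/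
theorem hasSum_comp_self
    (hf : ∀ᶠ x in 𝓝 (0 : ℝ), HasSum (fun j : ℕ => a (j + 2) * x ^ (j + 2)) (f x + x)) :
    ∀ᶠ x in 𝓝 (0 : ℝ),
      HasSum (fun j : ℕ => compCoeff a (j + 3) * x ^ (j + 3)) (f (f x) - x) := by
  have hexp := hasExpansion_of_hasSum (hasSum_jet hf)
  have han := analyticAt_of_hasSum hf
  obtain ⟨p, hp⟩ := han.comp_of_eq han (apply_zero_of_hasExpansion hexp)
  rw [hasFPowerSeriesAt_iff] at hp
  simp only [zero_add, smul_eq_mul] at hp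
  have hp' : ∀ᶠ x in 𝓝 (0 : ℝ), HasSum (fun j : ℕ =>
      PowerSeries.coeff j (PowerSeries.mk p.coeff) * x ^ j) (f (f x)) := by
    filter_upwards [hp] with x hx
    simpa [mul_comm] using hx
  have heq := (hasExpansion_of_hasSum hp').unique hexp.comp_self
  rw [heq] at hp'
  filter_upwards [hp'] with x hx
  rw [← hasSum_nat_add_iff' 3] at hx
  simpa [Finset.sum_range_succ, compCoeff_zero, compCoeff_one, compCoeff_two] using hx

theorem comp_self_sub_isBigO (h : HasExpansion f (jet a)) {n : ℕ} (hn : 3 ≤ n)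
    (h0 : ∀ j, 3 ≤ j → j < n → compCoeff a j = 0) :
    (fun x => f (f x) - x - compCoeff a n * x ^ n) =O[𝓝 0] fun x : ℝ => x ^ (n + 1) := by
  refine (h.comp_self (n + 1)).congr_left fun x => ?_
  rw [eval_trunc, Finset.sum_range_succ, Finset.sum_eq_single_of_mem 1 (by simp; omega)]
  · simp only [PowerSeries.coeff_mk, compCoeff_one]
    ring
  · intro j hj hj1
    rw [Finset.mem_range] at hj
    rw [PowerSeries.coeff_mk]
    have : compCoeff a j = 0 := by
      rcases lt_or_ge j 3 with h3 | h3
      · interval_cases j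
        · exact compCoeff_zero a
        · exact absurd rfl hj1
        · exact compCoeff_two a
      · exact h0 j h3 hj
    rw [this, zero_mul]

/-- The first nonzero coefficient of `f ∘ f - x` has odd order: with `g = f ∘ f` and
`g x = x + w x ^ n + ⋯`, comparing `f (g x) = f x - w x ^ n + ⋯` and
`g (f x) = f x + w (-x) ^ n + ⋯` gives `w = 0` for even `n`. -/
theorem compCoeff_eq_zero_of_even (hf : AnalyticAt ℝ f 0) (h : HasExpansion f (jet a)) {n : ℕ}
    (hn : 3 ≤ n) (hev : Even n) (h0 : ∀ j, 3 ≤ j → j < n → compCoeff a j = 0) :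
    compCoeff a n = 0 := by
  set w := compCoeff a n
  set u : ℝ → ℝ := fun x => f (f x) - x with hu
  have hf0 := apply_zero_of_hasExpansion h
  have hlim : Tendsto f (𝓝 0) (𝓝 0) := h.tendsto (coeff_zero_jet a)
  have hfO : f =O[𝓝 0] fun x : ℝ => x := by
    simpa using h.isBigO (n := 1) fun i hi => by rw [Nat.lt_one_iff.1 hi, coeff_zero_jet]
  have hsmall : (fun x : ℝ => x ^ (n + 1)) =o[𝓝 0] fun x : ℝ => x ^ n :=
    isLittleO_pow_pow (Nat.lt_succ_self n)
  have h1 : (fun x => u x - w * x ^ n) =o[𝓝 0] fun x : ℝ => x ^ n :=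
    (comp_self_sub_isBigO h hn h0).trans_isLittleO hsmall
  have huO : u =O[𝓝 0] fun x : ℝ => x ^ n := by
    refine (h1.isBigO.add ((isBigO_refl (fun x : ℝ => x ^ n) (𝓝 0)).const_mul_left w)).congr_left
      fun x => ?_
    ring
  -- the derivative of `f` at the origin is `-1`
  have hder : HasStrictDerivAt f (-1) 0 := by
    have h2 := hf.hasStrictDerivAt
    have h3 : HasDerivAt f (-1) 0 := by
      rw [hasDerivAt_iff_isLittleO]
      refine ((h 2).trans_isLittleO (isLittleO_pow_pow (m := 1) one_lt_two)).congr' ?_ ?_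
      · refine Eventually.of_forall fun x => ?_
        simp [eval_trunc, Finset.sum_range_succ, hf0]
      · exact Eventually.of_forall fun x => by simp
    rwa [h3.deriv] at h2
  have h4 : (fun x => f (f (f x)) - f x + u x) =o[𝓝 0] fun x : ℝ => x ^ n := by
    have h5 := hder.hasStrictFDerivAt.isLittleO
    have hg : Tendsto (fun x => f (f x)) (𝓝 0) (𝓝 0) := hlim.comp hlim
    have h6 : Tendsto (fun x : ℝ => (f (f x), x)) (𝓝 0) (𝓝 ((0 : ℝ), (0 : ℝ))) := by
      rw [nhds_prod_eq]
      exact hg.prodMk tendsto_id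
    refine ((h5.comp_tendsto h6).trans_isBigO huO).congr_left fun x => ?_
    simp only [Function.comp_apply, ContinuousLinearMap.toSpanSingleton_apply, smul_eq_mul, hu]
    ring
  have h7 : (fun x => u (f x) - w * f x ^ n) =o[𝓝 0] fun x : ℝ => x ^ n :=
    ((comp_self_sub_isBigO h hn h0).comp_tendsto hlim).trans_isLittleO
      ((hfO.pow (n + 1)).trans_isLittleO hsmall)
  have h8 : (fun x => f x ^ n - x ^ n) =o[𝓝 0] fun x : ℝ => x ^ n := by
    obtain ⟨H, hH⟩ := X_dvd_jet a
    have hH0 : PowerSeries.constantCoeff H = -1 := by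
      rw [← coeff_one_jet a, hH, show (1 : ℕ) = 0 + 1 from rfl, PowerSeries.coeff_succ_X_mul,
        PowerSeries.coeff_zero_eq_constantCoeff_apply]
    have hcn : PowerSeries.coeff n (jet a ^ n) = 1 := by
      have h3 := PowerSeries.coeff_X_pow_mul (H ^ n) n 0
      rw [zero_add] at h3
      rw [hH, mul_pow, h3, PowerSeries.coeff_zero_eq_constantCoeff_apply, map_pow, hH0,
        hev.neg_one_pow]
    refine ((h.pow n (n + 1)).trans_isLittleO hsmall).congr_left fun x => ?_
    rw [eval_trunc, Finset.sum_range_succ, Finset.sum_eq_zero, hcn]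
    · ring
    · intro i hi
      rw [coeff_jet_pow_of_lt a (Finset.mem_range.1 hi), zero_mul]
  have h9 : (fun x : ℝ => (2 * w) * x ^ n) =o[𝓝 0] fun x : ℝ => x ^ n := by
    refine (((h4.sub h1).sub h7).sub (h8.const_mul_left w)).congr_left fun x => ?_
    simp only [hu]
    ring
  by_contra hw
  have h10 := (isLittleO_const_mul_left_iff (mul_ne_zero two_ne_zero hw)).1 h9
  have h11 : ∀ᶠ x in 𝓝[≠] (0 : ℝ), x ^ n ≠ 0 :=
    eventually_mem_nhdsWithin.mono fun x hx => pow_ne_zero n hx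
  exact isLittleO_irrefl h11.frequently (h10.mono nhdsWithin_le_nhds)

end Analytic

/-! ### Stability of the origin -/

section Dynamics

open Asymptotics

variable {f : ℝ → ℝ} {n : ℕ}

/-- For odd `n`, a map `x + w x ^ n + O(x ^ (n + 1))` moves the points near the origin by about
`w |x| ^ n` away from it. -/
theorem abs_abs_sub_le {g : ℝ → ℝ} {w : ℝ} (hw : w ≠ 0) (hn : 3 ≤ n) (hodd : Odd n)
    (hg : (fun x => g x - x - w * x ^ n) =O[𝓝 0] fun x : ℝ => x ^ (n + 1)) :
    ∃ r > 0, ∀ x : ℝ, |x| < r → |(|g x| - (|x| + w * |x| ^ n))| ≤ |w| / 2 * |x| ^ n := by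
  have h1 := (hg.trans_isLittleO (isLittleO_pow_pow (Nat.lt_succ_self n))).def
    (half_pos (abs_pos.2 hw))
  have h2 : ∀ᶠ x in 𝓝 (0 : ℝ), 0 < 1 + w * x ^ (n - 1) := by
    have h3 : Tendsto (fun x : ℝ => 1 + w * x ^ (n - 1)) (𝓝 0) (𝓝 (1 + w * 0 ^ (n - 1))) :=
      Continuous.tendsto (by fun_prop) 0
    rw [zero_pow (by omega), mul_zero, add_zero] at h3
    exact h3.eventually (lt_mem_nhds one_pos)
  obtain ⟨r, hr, hball⟩ := Metric.eventually_nhds_iff.1 (h1.and h2)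
  refine ⟨r, hr, fun x hx => ?_⟩
  obtain ⟨h3, h4⟩ := hball (by simpa using hx)
  have hev : Even (n - 1) := by
    obtain ⟨m, rfl⟩ := hodd
    exact ⟨m, by omega⟩
  have hpow : ∀ y : ℝ, y ^ n = y * y ^ (n - 1) := fun y => by
    rw [← pow_succ', Nat.sub_add_cancel (by omega)]
  have h5 : |x| + w * |x| ^ n = |x + w * x ^ n| := by
    rw [hpow, hev.pow_abs, hpow, show x + w * (x * x ^ (n - 1)) = x * (1 + w * x ^ (n - 1)) by ring,
      abs_mul, abs_of_pos h4]
    ring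
  rw [h5]
  refine (abs_abs_sub_abs_le _ _).trans ?_
  rw [Real.norm_eq_abs, Real.norm_eq_abs, abs_pow] at h3
  rwa [← sub_sub]

theorem iterate_two_mul (f : ℝ → ℝ) (k : ℕ) (x : ℝ) : f^[2 * k] x = (fun y => f (f y))^[k] x := by
  rw [Function.iterate_mul]
  rfl

/-- If `f ∘ f` contracts towards the origin, then the origin is asymptotically stable for `f`. -/
theorem isLocallyAsymptoticallyStable_of_abs_le {c r : ℝ} (hc : 0 < c) (hr : 0 < r)
    (hf : ∀ x, |x| < r → |f x| ≤ 2 * |x|)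
    (hg : ∀ x, |x| < r → |f (f x)| ≤ |x| - c * |x| ^ n) : IsLocallyAsymptoticallyStable f := by
  set g : ℝ → ℝ := fun y => f (f y)
  have hstep : ∀ x, |x| < r → ∀ k, |g^[k] x| ≤ |x| := by
    intro x hx k
    induction k with
    | zero => exact le_rfl
    | succ k ih =>
      rw [Function.iterate_succ_apply']
      have := hg _ (ih.trans_lt hx)
      have h2 : 0 ≤ c * |g^[k] x| ^ n := by positivity
      linarith
  have hbound : ∀ x, |x| < r → ∀ k, |f^[k] x| ≤ 2 * |g^[k / 2] x| := by
    intro x hx k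
    obtain ⟨l, rfl | rfl⟩ := Nat.even_or_odd' k
    · rw [iterate_two_mul, Nat.mul_div_cancel_left _ two_pos]
      have : 0 ≤ |g^[l] x| := abs_nonneg _
      linarith
    · rw [Function.iterate_succ_apply', iterate_two_mul,
        show (2 * l + 1) / 2 = l by omega]
      exact hf _ ((hstep x hx l).trans_lt hx)
  refine ⟨fun ε hε => ⟨min r (ε / 2), lt_min hr (half_pos hε), fun x hx k => ?_⟩, r, hr,
    fun x hx => ?_⟩
  · rw [lt_min_iff] at hx
    have h1 := hbound x hx.1 k
    have h2 := hstep x hx.1 (k / 2)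
    linarith [hx.2]
  · have hanti : Antitone fun k => |g^[k] x| := by
      refine antitone_nat_of_succ_le fun k => ?_
      rw [Function.iterate_succ_apply']
      have h1 := hg _ ((hstep x hx k).trans_lt hx)
      have h2 : 0 ≤ c * |g^[k] x| ^ n := by positivity
      exact h1.trans (by linarith)
    -- the decreasing sequence of distances converges, and a positive limit would keep shrinking
    obtain ⟨L, hL⟩ : ∃ L, Tendsto (fun k => |g^[k] x|) atTop (𝓝 L) :=
      ⟨_, tendsto_atTop_ciInf hanti ⟨0, by rintro _ ⟨k, rfl⟩; exact abs_nonneg _⟩⟩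
    have hL0 : 0 ≤ L := ge_of_tendsto' hL fun k => abs_nonneg _
    have hLle : L ≤ L - c * L ^ n := by
      refine le_of_tendsto_of_tendsto' (hL.comp (tendsto_add_atTop_nat 1))
        (hL.sub ((hL.pow n).const_mul c)) fun k => ?_
      simp only [Function.comp_apply]
      rw [Function.iterate_succ_apply']
      exact hg _ ((hstep x hx k).trans_lt hx)
    have hLz : L = 0 := by
      by_contra hne
      have : 0 < c * L ^ n := mul_pos hc (pow_pos (lt_of_le_of_ne hL0 (Ne.symm hne)) n)
      linarith
    rw [hLz] at hL
    have hdiv : Tendsto (fun k : ℕ => k / 2) atTop atTop :=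
      tendsto_atTop_atTop.2 fun b => ⟨2 * b, fun k hk => by omega⟩
    refine squeeze_zero_norm (a := fun k => 2 * |g^[k / 2] x|) (fun k => hbound x hx k) ?_
    simpa using (hL.comp hdiv).const_mul 2

/-- If `f ∘ f` expands away from the origin, then the origin is a repeller for `f`. -/
theorem isRepeller_of_le_abs {c r : ℝ} (hc : 0 < c) (hr : 0 < r)
    (hg : ∀ x, |x| < r → |x| + c * |x| ^ n ≤ |f (f x)|) : IsRepeller f := by
  refine ⟨Metric.ball 0 r, Metric.ball_mem_nhds 0 hr, fun x _ hx0 => ?_⟩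
  by_contra! hstay
  set g : ℝ → ℝ := fun y => f (f y)
  have hin : ∀ k, |g^[k] x| < r := fun k => by
    have := hstay (2 * k)
    rwa [iterate_two_mul, mem_ball_zero_iff] at this
  have hd : 0 < c * |x| ^ n := mul_pos hc (pow_pos (abs_pos.2 hx0) n)
  have hgrow : ∀ k : ℕ, |x| + k * (c * |x| ^ n) ≤ |g^[k] x| := by
    intro k
    induction k with
    | zero => simp
    | succ k ih =>
      rw [Function.iterate_succ_apply']
      refine le_trans ?_ (hg _ (hin k))
      have h1 : |x| ≤ |g^[k] x| :=
        le_trans (le_add_of_nonneg_right (mul_nonneg k.cast_nonneg hd.le)) ih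
      have h2 : c * |x| ^ n ≤ c * |g^[k] x| ^ n := by gcongr
      push_cast
      linarith
  obtain ⟨k, hk⟩ := exists_nat_gt (r / (c * |x| ^ n))
  rw [div_lt_iff₀ hd] at hk
  have := hgrow k
  linarith [hin k, abs_nonneg x]

/-- The sign of the first nonzero coefficient of `f ∘ f - x` decides the stability of the
origin. -/
theorem stability_of_compCoeff {a : ℕ → ℝ} (h : HasExpansion f (jet a)) (hn : 3 ≤ n) (hodd : Odd n)
    (h0 : ∀ j, 3 ≤ j → j < n → compCoeff a j = 0) :
    (compCoeff a n < 0 → IsLocallyAsymptoticallyStable f) ∧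
      (0 < compCoeff a n → IsRepeller f) := by
  have hg := comp_self_sub_isBigO h hn h0
  constructor
  · intro hw
    obtain ⟨r, hr, H⟩ := abs_abs_sub_le (g := fun x => f (f x)) hw.ne hn hodd hg
    have hf : ∀ᶠ x in 𝓝 (0 : ℝ), |f x| ≤ 2 * |x| := by
      have h1 := (h 2).trans_isLittleO (isLittleO_pow_pow (m := 1) one_lt_two)
      filter_upwards [h1.def one_pos] with x hx
      simp only [eval_trunc, Finset.sum_range_succ, Finset.sum_range_zero, coeff_zero_jet,
        coeff_one_jet, Real.norm_eq_abs, pow_one, one_mul] at hx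
      have h2 : |f x| ≤ |f x - (0 + 0 * x ^ 0 + -1 * x)| + |-x| := by
        refine le_trans (le_of_eq ?_) (abs_add_le _ _)
        congr 1
        ring
      rw [abs_neg] at h2
      linarith
    obtain ⟨s, hs, hball⟩ := Metric.eventually_nhds_iff.1 hf
    refine isLocallyAsymptoticallyStable_of_abs_le (c := -compCoeff a n / 2) (r := min r s) (n := n)
      (by linarith) (lt_min hr hs) (fun x hx => hball ?_) fun x hx => ?_
    · simpa using hx.trans_le (min_le_right r s)
    · have h3 := (abs_le.1 (H x (hx.trans_le (min_le_left r s)))).2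
      rw [abs_of_neg hw] at h3
      linarith
  · intro hw
    obtain ⟨r, hr, H⟩ := abs_abs_sub_le (g := fun x => f (f x)) hw.ne' hn hodd hg
    refine isRepeller_of_le_abs (c := compCoeff a n / 2) (n := n) (half_pos hw) hr fun x hx => ?_
    have h3 := (abs_le.1 (H x hx)).1
    rw [abs_of_pos hw] at h3
    linarith

end Dynamics

/-! ### Integer computations with jets and monomials -/

/-- The sum of two polynomials over `ℤ` given by their lists of coefficients. -/
def addCoeffs : List ℤ → List ℤ → List ℤ
  | [], g => g
  | f, [] => f
  | x :: f, y :: g => (x + y) :: addCoeffs f g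

/-- The product modulo `x ^ n` of two polynomials over `ℤ` given by their lists of coefficients. -/
def mulTrunc : ℕ → List ℤ → List ℤ → List ℤ
  | 0, _, _ => []
  | _, [], _ => []
  | n + 1, x :: f, g =>
    if x = 0 then 0 :: mulTrunc n f g
    else addCoeffs ((g.take (n + 1)).map (x * ·)) (0 :: mulTrunc n f g)

/-- The composite `f ∘ g` modulo `x ^ n` by Horner's scheme, for polynomials `f` (the last
argument) and `g` over `ℤ` given by their lists of coefficients. -/
def compTrunc (n : ℕ) (g : List ℤ) : List ℤ → List ℤ
  | [] => []
  | x :: f => addCoeffs [x] (mulTrunc n g (compTrunc n g f))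

/-- The weakly decreasing lists of `d` indices `j`, each at least `2` and at most `m`, with
`∑ (j - 1) = w`, in lexicographically decreasing order. -/
def indexLists : ℕ → ℕ → ℕ → List (List ℕ)
  | 0, w, _ => if w = 0 then [[]] else []
  | d + 1, w, m => (List.range (m - 1)).reverse.flatMap fun i =>
      if i + 1 ≤ w then (indexLists d (w - (i + 1)) (i + 2)).map ((i + 2) :: ·) else []

/-- The monomials of weight `k - 1` in `a_2, …, a_k`, where `a_j` has weight `j - 1`, in increasing
graded reverse lexicographic order. A monomial is given by the weakly decreasing list of the
indices of its factors. -/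
def weightMonomials (k : ℕ) : List (List ℕ) :=
  (List.range k).flatMap fun d => indexLists d (k - 1) k

/-- The monomials of weight `k - 1` in the `a_j` of even order `j` and in `a_k`. -/
def evenMonomials (k : ℕ) : List (List ℕ) :=
  (weightMonomials k).filter fun l => l.all fun j => j % 2 == 0 || j == k

/-- Lists `l`, `m` of the same length are compared by `lexGt l m` if `l` is lexicographically
larger. -/
def lexGt : List ℕ → List ℕ → Bool
  | a :: l, b :: m => decide (b < a) || (a == b && lexGt l m)
  | _, _ => false

/-- The graded reverse lexicographic order on monomials given by weakly decreasing lists of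
indices. -/
def precedes (l m : List ℕ) : Bool :=
  decide (l.length < m.length) || (l.length == m.length && lexGt l m)

/-- The value of the monomial with indices `l` at the jet with coefficients `p`. -/
def monomialValue (p : List ℤ) (l : List ℕ) : ℤ := (l.map fun j => p.getD j 0).prod

/-- The values of the monomial with indices `l` at several jets. -/
def monomialValues (P : List (List ℤ)) (l : List ℕ) : List ℤ := P.map fun p => monomialValue p l

/-! ### Elimination with functionals -/

/-- The scalar product of two vectors. -/
def dotProd : List ℤ → List ℤ → ℤ
  | x :: c, y :: v => x * y + dotProd c v
  | _, _ => 0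

/-- The vector `p c - q d`. -/
def comb (p q : ℤ) : List ℤ → List ℤ → List ℤ
  | [], d => d.map fun y => -(q * y)
  | c, [] => c.map fun x => p * x
  | x :: c, y :: d => (p * x - q * y) :: comb p q c d

/-- The greatest common divisor of the entries of a vector. -/
def content : List ℤ → ℕ
  | [] => 0
  | x :: c => Nat.gcd x.natAbs (content c)

/-- A vector divided by the greatest common divisor of its entries. -/
def primPart (c : List ℤ) : List ℤ := c.map (· / (content c : ℤ))

/-- Replaces a list `K` of functionals by a basis of those combinations that vanish at `v`; it is
`none` if all of them vanish at `v`. -/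
def cut (v : List ℤ) : List (List ℤ) → Option (List (List ℤ))
  | [] => none
  | c :: K =>
    if dotProd c v = 0 then (cut v K).map (c :: ·)
    else some (K.map fun d => primPart (comb (dotProd c v) (dotProd d v) d c))

/-- The members of a list of labels whose vector `ev l` is linearly independent of those of the
labels before it; `K` is a list of functionals that vanish at the vectors treated so far. -/
def independentLabels {ι : Type*} (ev : ι → List ℤ) : List (List ℤ) → List ι → List ι
  | _, [] => []
  | K, l :: ms =>
    match cut (ev l) K with
    | none => independentLabels ev K ms
    | some K' => l :: independentLabels ev K' ms

/-- The coordinate functionals in dimension `n`. -/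
def coordinates (n : ℕ) : List (List ℤ) :=
  (List.range n).map fun i => (List.range n).map fun j => if i = j then 1 else 0

/-! ### Certificates for the listed formulas -/

/-- The coefficients of `1, x, …, x ^ 15` in some maps `f = -x + ⋯` with
`f ∘ f = x + O(x ^ 16)`. The coefficients of even order are small integers, chosen such that the
monomials of each even weight up to `14` in these coefficients are linearly independent as functions
on the first jets of the list; those of odd order are determined by them. -/
def involutionJets : List (List ℤ) :=
  [[0, -1, 1, -1, 0, 2, 0, -13, 0, 145, 0, -2328, 0, 49784, 0, -1358965],
   [0, -1, 1, -1, 1, -1, 0, 3, 0, -26, 0, 343, 0, -6251, 0, 150611],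
   [0, -1, 1, -1, -1, 5, 0, -33, 0, 416, 0, -7525, 0, 178535, 0, -5318185],
   [0, -1, 1, -1, 0, 2, 1, -17, 0, 180, 0, -2892, 0, 62166, 1, -1705117],
   [0, -1, 1, -1, 0, 2, 1, -17, 1, 175, 0, -2831, 0, 60892, 0, -1670143],
   [0, -1, 1, -1, 1, -1, 1, -1, 0, 4, 0, -50, 0, 916, 0, -22263],
   [0, -1, 1, -1, 1, -1, -1, 7, 0, -56, 0, 730, 0, -13152, 0, 313817],
   [0, -1, 1, -1, -1, 5, 0, -33, 0, 416, 1, -7531, 0, 178640, 0, -5321185],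
   [0, -1, 1, -1, -1, 5, 0, -33, 1, 411, 0, -7458, 0, 176995, 0, -5272187],
   [0, -1, 1, -1, 2, -4, 0, 15, 0, -97, 0, 818, 0, -9436, 0, 160259],
   [0, -1, 1, -1, -2, 8, 0, -57, 0, 787, 0, -15578, 0, 400372, 0, -12785869],
   [0, -1, 2, -4, 0, 32, 0, -832, 0, 37120, 0, -2383872, 1, 203915250, 0, -22265281376],
   [0, -1, 2, -4, 0, 32, 0, -832, 0, 37120, 1, -2383884, 0, 203916048, 0, -22265365376],
   [0, -1, 2, -4, 0, 32, 0, -832, 1, 37110, 0, -2383384, 0, 203874720, 0, -22260857092],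
   [0, -1, 1, -1, -1, 5, 1, -37, 0, 456, 0, -8260, 0, 196650, 1, -5876615],
   [0, -1, 1, -1, -1, 5, 1, -37, 0, 456, 0, -8260, 0, 196650, -1, -5876599],
   [0, -1, 1, -1, -1, 5, 1, -37, 0, 456, 0, -8260, 1, 196643, 0, -5876451],
   [0, -1, 1, -1, -1, 5, 1, -37, 0, 456, 1, -8266, 0, 196755, 0, -5879615],
   [0, -1, 1, -1, -1, 5, 1, -37, 1, 451, 0, -8193, 0, 195103, 0, -5830213],
   [0, -1, 1, -1, -1, 5, -1, -29, 0, 376, 0, -6796, 0, 160686, 1, -4770959],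
   [0, -1, 1, -1, 2, -4, 0, 15, 1, -102, 0, 867, 0, -10157, 0, 174301],
   [0, -1, 1, -1, 2, -4, 1, 11, 0, -72, 0, 596, 0, -6966, 0, 122391]]

/-- The jet of `-x + x ^ k` and the first `n - 1` of the `involutionJets`. -/
def testJets (k n : ℕ) : List (List ℤ) :=
  (List.replicate k 0 ++ [1]) :: involutionJets.take (n - 1)

/-- A common multiple of the denominators of a list of terms. -/
def denominator : List (ℤ × ℕ × List ℕ) → ℕ
  | [] => 1
  | t :: T => t.2.1 * (denominator T / Nat.gcd t.2.1 (denominator T))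

/-- The value at the jet `p`, multiplied by `D`, of the polynomial with terms `T`. -/
def scaledValue (D : ℕ) (p : List ℤ) (T : List (ℤ × ℕ × List ℕ)) : ℤ :=
  (T.map fun t => t.1 * (D / t.2.1 : ℕ) * monomialValue p t.2.2).sum

/-- The conditions, all of them decidable, under which the polynomial with terms `T` is the reduced
stability constant of odd order `k ≤ 15`: the order of the monomials, the independence of the
monomials in the coefficients of even order, the list of the monomials that are not leading
monomials, and the values at the test jets. -/
def isCertificate (k : ℕ) (T : List (ℤ × ℕ × List ℕ)) : Bool :=
  decide ((weightMonomials k).IsChain fun l m => precedes l m = true) &&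
  independentLabels (monomialValues (testJets k T.length)) (coordinates T.length)
    (evenMonomials k) == evenMonomials k &&
  independentLabels (monomialValues (testJets k T.length)) (coordinates T.length)
    (weightMonomials k) == T.map (fun t => t.2.2) &&
  denominator T != 0 && T.all (fun t => denominator T % t.2.1 == 0) &&
  scaledValue (denominator T) (List.replicate k 0 ++ [1]) T == -2 * (denominator T : ℤ) &&
  (involutionJets.take (T.length - 1)).all fun p => scaledValue (denominator T) p T == 0

/-- The terms of the listed formula of order `3`. -/
def terms3 : List (ℤ × ℕ × List ℕ) :=
  [(-2, 1, [3]),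
   (-2, 1, [2, 2])]

/-- The terms of the listed formula of order `5`. -/
def terms5 : List (ℤ × ℕ × List ℕ) :=
  [(-2, 1, [5]),
   (-6, 1, [4, 2]),
   (4, 1, [3, 3])]

/-- The terms of the listed formula of order `7`. -/
def terms7 : List (ℤ × ℕ × List ℕ) :=
  [(-2, 1, [7]),
   (-8, 1, [6, 2]),
   (13, 1, [5, 3]),
   (-4, 1, [4, 4]),
   (3, 1, [4, 3, 2])]

/-- The terms of the listed formula of order `9`. -/
def terms9 : List (ℤ × ℕ × List ℕ) :=
  [(-2, 1, [9]),
   (-10, 1, [8, 2]),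
   (358, 17, [7, 3]),
   (-10, 1, [6, 4]),
   (69, 17, [5, 5]),
   (242, 17, [6, 3, 2]),
   (-121, 17, [5, 4, 2])]

/-- The terms of the listed formula of order `11`. -/
def terms11 : List (ℤ × ℕ × List ℕ) :=
  [(-2, 1, [11]),
   (-12, 1, [10, 2]),
   (3865, 121, [9, 3]),
   (-12, 1, [8, 4]),
   (515, 242, [7, 5]),
   (-6, 1, [6, 6]),
   (4563, 121, [8, 3, 2]),
   (-11765, 242, [7, 4, 2]),
   (13, 2, [6, 5, 2]),
   (4407, 242, [6, 4, 3]),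
   (-936, 121, [5, 5, 3])]

/-- The terms of the listed formula of order `13`. -/
def terms13 : List (ℤ × ℕ × List ℕ) :=
  [(-2, 1, [13]),
   (-14, 1, [12, 2]),
   (62421386, 1428271, [11, 3]),
   (-14, 1, [10, 4]),
   (-29912981, 2856542, [9, 5]),
   (-14, 1, [8, 6]),
   (3323839, 329601, [7, 7]),
   (94587200, 1428271, [10, 3, 2]),
   (-304305945, 2856542, [9, 4, 2]),
   (2992379, 219734, [8, 5, 2]),
   (145516929, 2856542, [8, 4, 3]),
   (1939207, 329601, [7, 6, 2]),
   (-138885638, 4284813, [7, 5, 3]),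
   (-273943, 329601, [7, 4, 4]),
   (4183988, 1428271, [6, 6, 3]),
   (383791, 109867, [6, 5, 4])]

/-- The terms of the listed formula of order `15`. -/
def terms15 : List (ℤ × ℕ × List ℕ) :=
  [(-2, 1, [15]),
   (-16, 1, [14, 2]),
   (511907618, 8847103, [13, 3]),
   (-16, 1, [12, 4]),
   (-4393292988, 115012339, [11, 5]),
   (-16, 1, [10, 6]),
   (6893660012, 169026231, [9, 7]),
   (-8, 1, [8, 8]),
   (964610838, 8847103, [12, 3, 2]),
   (-1932055066, 8847103, [11, 4, 2]),
   (2073461406, 115012339, [10, 5, 2]),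
   (1324158696, 8847103, [10, 4, 3]),
   (102777002, 1396911, [9, 6, 2]),
   (-70657783876, 345037017, [9, 5, 3]),
   (888498472, 26541309, [9, 4, 4]),
   (10885500630, 1070499463, [8, 7, 2]),
   (178495020, 8847103, [8, 6, 3]),
   (2562962080, 115012339, [8, 5, 4]),
   (-10948144126, 1070499463, [7, 7, 3]),
   (-4032962292, 1070499463, [7, 6, 4]),
   (-150876019048, 13916493019, [7, 5, 5]),
   (546329272, 115012339, [6, 6, 5]),
   (-6188200, 465637, [8, 5, 3, 2])]

/-! ### Correctness of the composition of jets -/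

section Composition

open PowerSeries

/-- The polynomial over `ℤ` with a given list of coefficients, as a power series. -/
noncomputable def toSeries : List ℤ → PowerSeries ℤ
  | [] => 0
  | x :: f => C x + X * toSeries f

theorem coeff_toSeries (f : List ℤ) (j : ℕ) : coeff j (toSeries f) = f.getD j 0 := by
  induction f generalizing j with
  | nil => simp [toSeries]
  | cons x f ih =>
    cases j with
    | zero => simp [toSeries]
    | succ j => rw [toSeries, map_add, coeff_succ_X_mul, coeff_succ_C, ih]; simp

theorem toSeries_addCoeffs (f g : List ℤ) :
    toSeries (addCoeffs f g) = toSeries f + toSeries g := by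
  induction f generalizing g with
  | nil => simp [addCoeffs, toSeries]
  | cons x f ih =>
    cases g with
    | nil => simp [addCoeffs, toSeries]
    | cons y g =>
      simp only [addCoeffs, toSeries, ih, map_add]
      ring

theorem toSeries_map_mul (x : ℤ) (f : List ℤ) :
    toSeries (f.map (x * ·)) = C x * toSeries f := by
  induction f with
  | nil => simp [toSeries]
  | cons y f ih =>
    simp only [List.map_cons, toSeries, ih, map_mul]
    ring

theorem X_pow_dvd_toSeries_take (n : ℕ) (f : List ℤ) :
    X ^ n ∣ toSeries (f.take n) - toSeries f := by
  refine X_pow_dvd_iff.2 fun i hi => ?_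
  rw [map_sub, coeff_toSeries, coeff_toSeries, sub_eq_zero]
  simp [List.getD_eq_getElem?_getD, hi]

theorem X_pow_dvd_toSeries_mulTrunc (n : ℕ) (f g : List ℤ) :
    X ^ n ∣ toSeries (mulTrunc n f g) - toSeries f * toSeries g := by
  induction f generalizing n with
  | nil => cases n <;> simp [mulTrunc, toSeries]
  | cons x f ih =>
    cases n with
    | zero => simp
    | succ n =>
      have h1 : X ^ (n + 1) ∣ X * (toSeries (mulTrunc n f g) - toSeries f * toSeries g) := by
        rw [pow_succ']
        exact mul_dvd_mul_left X (ih n)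
      rw [mulTrunc]
      split_ifs with hx
      · convert h1 using 1
        simp only [toSeries, hx, map_zero]
        ring
      · rw [toSeries_addCoeffs, toSeries_map_mul]
        have h2 := ((X_pow_dvd_toSeries_take (n + 1) g).mul_left (C x)).add h1
        convert h2 using 1
        simp only [toSeries, map_zero]
        ring

theorem X_pow_dvd_toSeries_compTrunc (n : ℕ) (g f : List ℤ) :
    X ^ n ∣ toSeries (compTrunc n g f) -
      ∑ i ∈ Finset.range f.length, C (f.getD i 0) * toSeries g ^ i := by
  induction f with
  | nil => simp [compTrunc, toSeries]
  | cons x f ih =>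
    rw [compTrunc, toSeries_addCoeffs, List.length_cons, Finset.sum_range_succ']
    have h := (X_pow_dvd_toSeries_mulTrunc n g (compTrunc n g f)).add (ih.mul_left (toSeries g))
    convert h using 1
    simp only [toSeries, List.getD_cons_succ, List.getD_cons_zero, mul_zero, add_zero, pow_zero,
      mul_one, mul_sub, Finset.mul_sum]
    rw [Finset.sum_congr rfl fun i _ => show C (f.getD i 0) * toSeries g ^ (i + 1) =
      toSeries g * (C (f.getD i 0) * toSeries g ^ i) by ring]
    ring

theorem getD_compTrunc {p : List ℤ} (h0 : p.getD 0 0 = 0) (h1 : p.getD 1 0 = -1) {n j : ℕ}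
    (hj : j < n) : (compTrunc n p p).getD j 0 = compCoeff (fun i => p.getD i 0) j := by
  have hp : toSeries p = jet fun i => p.getD i 0 := by
    ext i
    rw [coeff_toSeries, coeff_jet]
    split_ifs with hi hi
    · rw [hi, h0]
    · rw [hi, h1]
    · rfl
  have h := X_pow_dvd_iff.1 (X_pow_dvd_toSeries_compTrunc n p p) j hj
  rw [map_sub, sub_eq_zero, coeff_toSeries] at h
  rw [h, compCoeff_eq_sum _ (show j < max p.length (j + 1) by simp), map_sum]
  simp only [coeff_C_mul]
  rw [← hp]
  simp only [coeff_toSeries]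
  refine Finset.sum_subset (Finset.range_mono (le_max_left _ _)) fun i _ hi => ?_
  rw [List.getD_eq_default _ _ (by simpa using hi), zero_mul]

end Composition

/-! ### Correctness of the elimination -/

section Elimination

variable {V : Type*} [AddCommGroup V] [Module ℚ V]

/-- The combination of the functionals `φ` with coefficients `c`. -/
noncomputable def pairing : List ℤ → List (V →ₗ[ℚ] ℚ) → (V →ₗ[ℚ] ℚ)
  | x :: c, φ :: Φ => (x : ℚ) • φ + pairing c Φ
  | _, _ => 0

theorem pairing_nil_left (Φ : List (V →ₗ[ℚ] ℚ)) : pairing [] Φ = 0 := by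
  cases Φ <;> rfl

theorem pairing_nil_right (c : List ℤ) : pairing c ([] : List (V →ₗ[ℚ] ℚ)) = 0 := by
  cases c <;> rfl

theorem pairing_apply (c : List ℤ) {Φ : List (V →ₗ[ℚ] ℚ)} {x : V} {v : List ℤ}
    (h : Φ.map (fun φ => φ x) = v.map fun y : ℤ => (y : ℚ)) : pairing c Φ x = dotProd c v := by
  induction Φ generalizing c v with
  | nil =>
    obtain rfl : v = [] := by simpa using h.symm
    rw [pairing_nil_right]
    cases c <;> simp [dotProd]
  | cons φ Φ ih =>
    cases v with
    | nil => simp at h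
    | cons y v =>
      rw [List.map_cons, List.map_cons, List.cons.injEq] at h
      cases c with
      | nil => simp [pairing, dotProd]
      | cons z c => simp [pairing, dotProd, ih c h.2, h.1]

theorem pairing_comb (p q : ℤ) (c d : List ℤ) (Φ : List (V →ₗ[ℚ] ℚ)) :
    pairing (comb p q c d) Φ = (p : ℚ) • pairing c Φ - (q : ℚ) • pairing d Φ := by
  induction Φ generalizing c d with
  | nil => simp [pairing_nil_right]
  | cons φ Φ ih =>
    cases c with
    | nil =>
      cases d with
      | nil => simp [comb, pairing]
      | cons y d =>
        have h := ih [] d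
        simp only [comb] at h
        simp only [comb, List.map_cons, pairing, h]
        push_cast
        module
    | cons x c =>
      cases d with
      | nil =>
        have h := ih c []
        have h2 : comb p q c [] = c.map fun x => p * x := by cases c <;> rfl
        rw [h2] at h
        simp only [comb, List.map_cons, pairing, h]
        push_cast
        module
      | cons y d =>
        simp only [comb, pairing, ih c d]
        push_cast
        module

theorem content_dvd {c : List ℤ} {x : ℤ} (hx : x ∈ c) : (content c : ℤ) ∣ x := by
  induction c with
  | nil => simp at hx
  | cons y c ih =>
    rw [content]
    rcases List.mem_cons.1 hx with rfl | hx
    · exact Int.natCast_dvd.2 (Nat.gcd_dvd_left _ _)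
    · exact (Int.natCast_dvd_natCast.2 (Nat.gcd_dvd_right _ _)).trans (ih hx)

theorem pairing_map_ediv {g : ℤ} {c : List ℤ} (h : ∀ x ∈ c, g ∣ x) (Φ : List (V →ₗ[ℚ] ℚ)) :
    (g : ℚ) • pairing (c.map (· / g)) Φ = pairing c Φ := by
  induction Φ generalizing c with
  | nil => simp [pairing_nil_right]
  | cons φ Φ ih =>
    cases c with
    | nil => simp [pairing]
    | cons x c =>
      have h1 : (g : ℚ) * ((x / g : ℤ) : ℚ) = x := by
        exact_mod_cast Int.mul_ediv_cancel' (h x (by simp))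
      have h2 := ih (c := c) fun y hy => h y (by simp [hy])
      simp only [List.map_cons, pairing, smul_add, h2, smul_smul, h1]

theorem pairing_primPart_eq_zero {c : List ℤ} {Φ : List (V →ₗ[ℚ] ℚ)} {x : V}
    (h : pairing c Φ x = 0) : pairing (primPart c) Φ x = 0 := by
  rcases eq_or_ne (content c : ℤ) 0 with h0 | h0
  · -- division by zero is zero, so that the vector vanishes
    have h1 : ∀ (d : List ℤ) (Φ : List (V →ₗ[ℚ] ℚ)), pairing (d.map (· / (0 : ℤ))) Φ = 0 := by
      intro d
      induction d with
      | nil => exact pairing_nil_left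
      | cons y d ih =>
        intro Φ
        cases Φ with
        | nil => rfl
        | cons φ Φ => simp [pairing, ← ih Φ]
    rw [primPart, h0, h1]
    rfl
  · have h1 := congrArg (fun ψ => ψ x) (pairing_map_ediv (fun y hy => content_dvd hy) Φ (c := c))
    simp only [LinearMap.smul_apply, h, smul_eq_mul, mul_eq_zero] at h1
    exact h1.resolve_left (by exact_mod_cast h0)

theorem dotProd_eq_zero_of_cut_eq_none {v : List ℤ} {K : List (List ℤ)} (h : cut v K = none) :
    ∀ c ∈ K, dotProd c v = 0 := by
  induction K with
  | nil => simp
  | cons c K ih =>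
    rw [cut] at h
    split_ifs at h with hc
    rw [Option.map_eq_none_iff] at h
    simpa [hc] using ih h

theorem cut_spec {Φ : List (V →ₗ[ℚ] ℚ)} {x : V} {v : List ℤ}
    (hv : Φ.map (fun φ => φ x) = v.map fun y : ℤ => (y : ℚ)) {K K' : List (List ℤ)}
    (h : cut v K = some K') :
    (∃ c ∈ K, pairing c Φ x ≠ 0) ∧ ∀ d ∈ K', pairing d Φ x = 0 ∧
      ∀ y, (∀ c ∈ K, pairing c Φ y = 0) → pairing d Φ y = 0 := by
  induction K generalizing K' with
  | nil => simp [cut] at h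
  | cons c K ih =>
    rw [cut] at h
    split_ifs at h with hc
    · obtain ⟨K'', hK'', rfl⟩ := Option.map_eq_some_iff.1 h
      obtain ⟨⟨e, he, hex⟩, h2⟩ := ih hK''
      refine ⟨⟨e, by simp [he], hex⟩, fun d hd => ?_⟩
      rcases List.mem_cons.1 hd with rfl | hd
      · exact ⟨by rw [pairing_apply d hv, hc, Int.cast_zero], fun y hy => hy d (by simp)⟩
      · exact ⟨(h2 d hd).1, fun y hy => (h2 d hd).2 y fun e he => hy e (by simp [he])⟩
    · rw [Option.some.injEq] at h
      subst h
      refine ⟨⟨c, by simp, ?_⟩, fun d hd => ?_⟩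
      · rw [pairing_apply c hv]
        exact_mod_cast hc
      · obtain ⟨e, he, rfl⟩ := List.mem_map.1 hd
        constructor
        · refine pairing_primPart_eq_zero ?_
          rw [pairing_comb, LinearMap.sub_apply, LinearMap.smul_apply, LinearMap.smul_apply,
            pairing_apply c hv, pairing_apply e hv, smul_eq_mul, smul_eq_mul]
          ring
        · intro y hy
          refine pairing_primPart_eq_zero ?_
          rw [pairing_comb, LinearMap.sub_apply, LinearMap.smul_apply, LinearMap.smul_apply,
            hy c (by simp), hy e (by simp [he]), smul_zero, smul_zero, sub_zero]

variable {ι : Type*} {ev : ι → List ℤ} {b : ι → V} {Φ : List (V →ₗ[ℚ] ℚ)}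

theorem mem_of_mem_independentLabels {K : List (List ℤ)} {ms : List ι} {l : ι}
    (hl : l ∈ independentLabels ev K ms) : l ∈ ms := by
  induction ms generalizing K with
  | nil => simp [independentLabels] at hl
  | cons h ms ih =>
    rw [independentLabels] at hl
    split at hl
    · exact List.mem_cons_of_mem _ (ih hl)
    · exact List.mem_cons.2 ((List.mem_cons.1 hl).imp_right ih)

/-- Each label kept by the elimination has a functional that detects its vector and vanishes at
the vectors of all the labels before it. -/
theorem exists_functional_of_mem_independentLabels {R : ι → ι → Prop} {ms : List ι}
    (hev : ∀ l ∈ ms, Φ.map (fun φ => φ (b l)) = (ev l).map fun y : ℤ => (y : ℚ))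
    (hR : ms.Pairwise R) (K : List (List ℤ)) {l : ι} (hl : l ∈ independentLabels ev K ms) :
    ∃ ψ : V →ₗ[ℚ] ℚ, ψ (b l) ≠ 0 ∧ (∀ y, (∀ c ∈ K, pairing c Φ y = 0) → ψ y = 0) ∧
      ∀ l' ∈ ms, ¬ R l l' → l' ≠ l → ψ (b l') = 0 := by
  induction ms generalizing K with
  | nil => simp [independentLabels] at hl
  | cons h ms ih =>
    rw [List.pairwise_cons] at hR
    have hev' : ∀ l ∈ ms, Φ.map (fun φ => φ (b l)) = (ev l).map fun y : ℤ => (y : ℚ) :=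
      fun l hl => hev l (by simp [hl])
    rw [independentLabels] at hl
    split at hl
    · next hcut =>
      obtain ⟨ψ, h1, h2, h3⟩ := ih hev' hR.2 K hl
      refine ⟨ψ, h1, h2, fun l' hl' => ?_⟩
      rcases List.mem_cons.1 hl' with rfl | hl'
      · intro _ _
        refine h2 _ fun c hc => ?_
        rw [pairing_apply c (hev l' (by simp)), dotProd_eq_zero_of_cut_eq_none hcut c hc,
          Int.cast_zero]
      · exact h3 l' hl'
    · next K' hcut =>
      obtain ⟨⟨c, hc, hcx⟩, hK'⟩ := cut_spec (hev h (by simp)) hcut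
      by_cases hlh : l = h
      · subst hlh
        refine ⟨pairing c Φ, hcx, fun y hy => hy c hc, fun l' hl' hn hne => ?_⟩
        rcases List.mem_cons.1 hl' with rfl | hl'
        · exact absurd rfl hne
        · exact absurd (hR.1 l' hl') hn
      · obtain ⟨ψ, h1, h2, h3⟩ := ih hev' hR.2 K' (List.mem_of_ne_of_mem hlh hl)
        refine ⟨ψ, h1, fun y hy => h2 y fun d hd => (hK' d hd).2 y hy, fun l' hl' => ?_⟩
        rcases List.mem_cons.1 hl' with rfl | hl'
        · exact fun _ _ => h2 _ fun d hd => (hK' d hd).1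
        · exact h3 l' hl'

theorem length_independentLabels_le (K : List (List ℤ)) (ms : List ι) :
    (independentLabels ev K ms).length ≤ ms.length := by
  induction ms generalizing K with
  | nil => simp [independentLabels]
  | cons l ms ih =>
    rw [independentLabels]
    split
    · exact (ih K).trans (Nat.le_succ _)
    · exact Nat.succ_le_succ (ih _)

/-- If the elimination keeps all labels, then the functionals separate the points of the span of
the vectors. -/
theorem eq_zero_of_independentLabels_eq_self {ms : List ι}
    (hev : ∀ l ∈ ms, Φ.map (fun φ => φ (b l)) = (ev l).map fun y : ℤ => (y : ℚ))
    (K : List (List ℤ)) (hms : independentLabels ev K ms = ms) {y : V}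
    (hy : y ∈ Submodule.span ℚ {x | ∃ l ∈ ms, b l = x}) (hK : ∀ c ∈ K, pairing c Φ y = 0) :
    y = 0 := by
  induction ms generalizing K y with
  | nil => simpa using hy
  | cons h ms ih =>
    have hset : {x | ∃ l ∈ h :: ms, b l = x} = insert (b h) {x | ∃ l ∈ ms, b l = x} := by
      ext x
      simp [eq_comm]
    rw [hset, Submodule.mem_span_insert] at hy
    obtain ⟨r, z, hz, rfl⟩ := hy
    rw [independentLabels] at hms
    split at hms
    · have h1 := length_independentLabels_le (ev := ev) K ms
      rw [hms, List.length_cons] at h1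
      omega
    · next K' hcut =>
      obtain ⟨⟨c, hc, hcx⟩, hK'⟩ := cut_spec (hev h (by simp)) hcut
      have hz0 : z = 0 := by
        refine ih (fun l hl => hev l (by simp [hl])) K' (List.cons.inj hms).2 hz fun d hd => ?_
        have h1 := (hK' d hd).2 _ hK
        rwa [map_add, map_smul, (hK' d hd).1, smul_zero, zero_add] at h1
      have h2 := hK c hc
      rw [hz0, add_zero, map_smul, smul_eq_mul, mul_eq_zero] at h2
      rw [hz0, h2.resolve_right hcx, zero_smul, add_zero]

end Elimination

/-! ### Monomials as lists of indices -/

section Monomials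

open MvPolynomial

open scoped MonomialOrder

/-- The weakly decreasing lists of indices between `2` and `m`: they stand for the monomials in
`a_2, …, a_m`. -/
def IsIndexList (m : ℕ) (l : List ℕ) : Prop :=
  l.Pairwise (fun i j => j ≤ i) ∧ ∀ j ∈ l, 2 ≤ j ∧ j ≤ m

/-- The weight of a monomial, where `a_j` has weight `j - 1`. -/
def indexWeight (l : List ℕ) : ℕ := (l.map (· - 1)).sum

/-- The exponent vector of the monomial with indices `l`. -/
noncomputable def indexExponent (k : ℕ) (l : List ℕ) : Finset.Icc 2 k →₀ ℕ :=
  Finsupp.equivFunOnFinite.symm fun i => l.count (i : ℕ)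

theorem mem_indexLists {d w m : ℕ} {l : List ℕ} :
    l ∈ indexLists d w m ↔ l.length = d ∧ indexWeight l = w ∧ IsIndexList m l := by
  induction d generalizing w m l with
  | zero =>
    rw [indexLists]
    split_ifs with hw
    · simp only [List.mem_singleton, List.length_eq_zero_iff]
      constructor
      · rintro rfl
        simp [indexWeight, IsIndexList, hw]
      · exact fun h => h.1
    · simp only [List.not_mem_nil, List.length_eq_zero_iff, false_iff, not_and]
      rintro rfl h
      exact absurd h.symm hw
  | succ d ih =>
    simp only [indexLists, List.mem_flatMap, List.mem_reverse, List.mem_range]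
    constructor
    · rintro ⟨i, hi, hl⟩
      split_ifs at hl with hiw
      · obtain ⟨l', hl', rfl⟩ := List.mem_map.1 hl
        obtain ⟨h1, h2, h3, h4⟩ := ih.1 hl'
        refine ⟨by simp [h1], ?_, List.pairwise_cons.2 ⟨fun j hj => (h4 j hj).2, h3⟩,
          fun j hj => ?_⟩
        · simp only [indexWeight, List.map_cons, List.sum_cons] at h2 ⊢
          omega
        · rcases List.mem_cons.1 hj with rfl | hj
          · omega
          · have := h4 j hj
            omega
      · simp at hl
    · rintro ⟨h1, h2, h3, h4⟩
      cases l with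
      | nil => simp at h1
      | cons i l =>
        have hi := h4 i (by simp)
        simp only [indexWeight, List.map_cons, List.sum_cons] at h2
        rw [List.pairwise_cons] at h3
        refine ⟨i - 2, by omega, ?_⟩
        rw [if_pos (by omega), List.mem_map]
        refine ⟨l, ih.2 ⟨by simpa using h1, ?_, h3.2, fun j hj => ⟨(h4 j (by simp [hj])).1, ?_⟩⟩,
          by rw [Nat.sub_add_cancel hi.1]⟩
        · simp only [indexWeight]
          omega
        · have := h3.1 j hj
          omega

theorem mem_weightMonomials {k : ℕ} (hk : 1 ≤ k) {l : List ℕ} :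
    l ∈ weightMonomials k ↔ indexWeight l = k - 1 ∧ IsIndexList k l := by
  simp only [weightMonomials, List.mem_flatMap, List.mem_range, mem_indexLists]
  constructor
  · rintro ⟨d, -, -, h⟩
    exact h
  · rintro ⟨h1, h2⟩
    refine ⟨l.length, ?_, rfl, h1, h2⟩
    have h3 : l.length ≤ indexWeight l := by
      have := List.length_le_sum_of_one_le (l.map (· - 1)) fun x hx => by
        obtain ⟨j, hj, rfl⟩ := List.mem_map.1 hx
        have := (h2.2 j hj).1
        omega
      simpa [indexWeight] using this
    omega

theorem exists_indexExponent_eq {k : ℕ} (ν : Finset.Icc 2 k →₀ ℕ) :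
    ∃ l, IsIndexList k l ∧ indexExponent k l = ν := by
  classical
  refine ⟨((Finsupp.toMultiset ν).map Subtype.val).sort (· ≥ ·), ⟨?_, ?_⟩, ?_⟩
  · exact Multiset.pairwise_sort _ _
  · intro j hj
    obtain ⟨i, -, rfl⟩ := Multiset.mem_map.1 ((Multiset.mem_sort _).1 hj)
    exact Finset.mem_Icc.1 i.2
  · ext i
    simp only [indexExponent, Finsupp.equivFunOnFinite_symm_apply_apply]
    rw [← Multiset.coe_count, Multiset.sort_eq,
      Multiset.count_map_eq_count' _ _ Subtype.val_injective, Finsupp.count_toMultiset]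

theorem coeffVar_eq {k j : ℕ} (hj : 2 ≤ j ∧ j ≤ k) :
    coeffVar k j = X ⟨j, Finset.mem_Icc.2 hj⟩ :=
  dif_pos (Finset.mem_Icc.2 hj)

theorem indexExponent_cons {k j : ℕ} (hj : 2 ≤ j ∧ j ≤ k) (l : List ℕ) :
    indexExponent k (j :: l) =
      Finsupp.single ⟨j, Finset.mem_Icc.2 hj⟩ 1 + indexExponent k l := by
  ext i
  simp only [indexExponent, Finsupp.equivFunOnFinite_symm_apply_apply, Finsupp.add_apply,
    List.count_cons, Finsupp.single_apply, Subtype.ext_iff, beq_iff_eq]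
  exact add_comm _ _

theorem monomial_indexExponent {k : ℕ} {l : List ℕ} (hl : ∀ j ∈ l, 2 ≤ j ∧ j ≤ k) :
    monomial (indexExponent k l) (1 : ℚ) = (l.map (coeffVar k)).prod := by
  induction l with
  | nil =>
    have : indexExponent k [] = 0 := by
      ext i
      simp [indexExponent]
    simp [this]
  | cons j l ih =>
    have hj := hl j (by simp)
    rw [indexExponent_cons hj, List.map_cons, List.prod_cons,
      ← ih fun i hi => hl i (by simp [hi]), coeffVar_eq hj, X, monomial_mul, one_mul]

theorem degree_indexExponent {k : ℕ} {l : List ℕ} (hl : ∀ j ∈ l, 2 ≤ j ∧ j ≤ k) :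
    Finsupp.degree (indexExponent k l) = l.length := by
  induction l with
  | nil =>
    have : indexExponent k [] = 0 := by
      ext i
      simp [indexExponent]
    simp [this]
  | cons j l ih =>
    rw [indexExponent_cons (hl j (by simp)), map_add, ih fun i hi => hl i (by simp [hi]),
      Finsupp.degree_single, List.length_cons, add_comm]

/-- At the first place where two weakly decreasing lists differ, the larger entry is the last
variable in which the exponents differ. -/
theorem exists_count_lt_of_lexGt {l m : List ℕ} (hl : l.Pairwise fun i j => j ≤ i)
    (hm : m.Pairwise fun i j => j ≤ i) (h : lexGt l m = true) :
    ∃ i, (∀ j, i < j → l.count j = m.count j) ∧ m.count i < l.count i := by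
  induction l generalizing m with
  | nil => simp [lexGt] at h
  | cons a l ih =>
    cases m with
    | nil => simp [lexGt] at h
    | cons b m =>
      rw [List.pairwise_cons] at hl hm
      simp only [lexGt, Bool.or_eq_true, decide_eq_true_eq, Bool.and_eq_true, beq_iff_eq] at h
      rcases h with hba | ⟨rfl, h⟩
      · have h1 : ∀ j, a ≤ j → (b :: m).count j = 0 := fun j hj =>
          List.count_eq_zero.2 fun hmem => by
            rcases List.mem_cons.1 hmem with rfl | hmem
            · omega
            · have := hm.1 j hmem
              omega
        refine ⟨a, fun j hj => ?_, ?_⟩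
        · rw [h1 j hj.le]
          refine List.count_eq_zero.2 fun hmem => ?_
          rcases List.mem_cons.1 hmem with rfl | hmem
          · omega
          · have := hl.1 j hmem
            omega
        · rw [h1 a le_rfl]
          simp
      · obtain ⟨i, h1, h2⟩ := ih hl.2 hm.2 h
        refine ⟨i, fun j hj => ?_, ?_⟩
        · simp only [List.count_cons, h1 j hj]
        · simp only [List.count_cons]
          omega

theorem indexExponent_lt_of_precedes {k : ℕ} {l m : List ℕ} (hl : IsIndexList k l)
    (hm : IsIndexList k m) (h : precedes l m = true) :
    indexExponent k l ≺[grevlex (Finset.Icc 2 k)] indexExponent k m := by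
  refine GrevlexExp.ofExp_lt_iff.2 ?_
  rw [degree_indexExponent hl.2, degree_indexExponent hm.2]
  simp only [precedes, Bool.or_eq_true, decide_eq_true_eq, Bool.and_eq_true, beq_iff_eq] at h
  refine h.imp_right fun h => ⟨h.1, ?_⟩
  obtain ⟨i, h1, h2⟩ := exists_count_lt_of_lexGt hl.1 hm.1 h.2
  have hi : i ∈ l := List.count_pos_iff.1 (by omega)
  exact ⟨⟨i, Finset.mem_Icc.2 (hl.2 i hi)⟩, fun j hj => h1 j hj, h2⟩

end Monomials

/-! ### The ideal of the lower stability constants -/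

section StabIdeal

open scoped MonomialOrder

theorem stabPoly_eq (k j : ℕ) : stabPoly k j = compCoeff (coeffVar k) j := by
  have h : genericMap k = jet (coeffVar k) := by
    ext1 i
    rw [coeff_jet, genericMap, PowerSeries.coeff_mk]
    split_ifs with h1 h0 h0
    · omega
    · rfl
    · rw [h0, coeffVar, dif_neg (by simp)]
    · rfl
  rw [stabPoly, compCoeff, h]

theorem map_stabPoly {A : Type*} [CommRing A] {k : ℕ} (φ : CoeffRing k →+* A) {a : ℕ → A}
    (ha : ∀ i, 2 ≤ i → i ≤ k → φ (coeffVar k i) = a i) {j : ℕ} (hj : j ≤ k) :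
    φ (stabPoly k j) = compCoeff a j := by
  rw [stabPoly_eq, map_compCoeff]
  exact compCoeff_congr fun i hi hij => ha i hi (hij.trans hj)

theorem aeval_coeffVar {A : Type*} [CommRing A] [Algebra ℚ A] {k : ℕ} (a : ℕ → A) {i : ℕ}
    (hi : 2 ≤ i ∧ i ≤ k) :
    MvPolynomial.aeval (fun i : Finset.Icc 2 k => a i) (coeffVar k i) = a i := by
  rw [coeffVar_eq hi, MvPolynomial.aeval_X]

theorem evalAt_stabPoly (a : ℕ → ℝ) {k j : ℕ} (hj : j ≤ k) :
    evalAt a (stabPoly k j) = compCoeff a j :=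
  map_stabPoly (MvPolynomial.aeval fun i : Finset.Icc 2 k => a i).toRingHom
    (fun _ hi hik => aeval_coeffVar a ⟨hi, hik⟩) hj

theorem evalAt_eq_zero_of_mem_stabIdeal {a : ℕ → ℝ} {k : ℕ}
    (h : ∀ j, 3 ≤ j → j < k → compCoeff a j = 0) {q : CoeffRing k} (hq : q ∈ stabIdeal k) :
    evalAt a q = 0 := by
  have hle : stabIdeal k ≤ RingHom.ker
      (MvPolynomial.aeval (R := ℚ) fun i : Finset.Icc 2 k => a i).toRingHom := by
    refine Ideal.span_le.2 ?_
    rintro _ ⟨j, hj, hjk, rfl⟩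
    exact (evalAt_stabPoly a hjk.le).trans (h j hj hjk)
  exact hle hq

/-! ### Jets as functionals -/

/-- The coefficient `t ^ (j - 1) p_j` of `x ^ j` in the rescaled map `f (t x) / t`, where `p` is
the list of coefficients of `f`. -/
noncomputable def rescaledJet (p : List ℤ) (j : ℕ) : Polynomial ℚ :=
  Polynomial.monomial (j - 1) ((p.getD j 0 : ℤ) : ℚ)

theorem compCoeff_rescaledJet (p : List ℤ) {J : ℕ} (hJ : 2 ≤ J) :
    compCoeff (rescaledJet p) J =
      Polynomial.monomial (J - 1) ((compCoeff (fun j => p.getD j 0) J : ℤ) : ℚ) := by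
  let M : ℕ → AddSubgroup (Polynomial ℚ) := fun w =>
    (Polynomial.monomial (R := ℚ) w).toAddMonoidHom.range
  have hp : ∀ l, rescaledJet p l ∈ M (l - 1) := fun l => ⟨_, rfl⟩
  have h := compCoeff_mem_of_graded (M := M) ⟨1, rfl⟩ (by
    rintro u v _ ⟨x, rfl⟩ _ ⟨y, rfl⟩
    exact ⟨x * y, (Polynomial.monomial_mul_monomial u v x y).symm⟩) (rescaledJet p) hJ
    fun l _ _ => hp l
  have h2 : (-1) ^ J * rescaledJet p J ∈ M (J - 1) := by
    rcases neg_one_pow_eq_or (Polynomial ℚ) J with h1 | h1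
    · rw [h1, one_mul]; exact hp J
    · rw [h1, neg_one_mul]; exact neg_mem (hp J)
  have h3 : compCoeff (rescaledJet p) J ∈ M (J - 1) := by
    have h4 := add_mem (sub_mem h (hp J)) h2
    convert h4 using 1
    ring
  obtain ⟨c, hc⟩ := h3
  replace hc : Polynomial.monomial (J - 1) c = compCoeff (rescaledJet p) J := hc
  rw [← hc]
  congr 1
  have h5 := congrArg (Polynomial.evalRingHom 1) hc
  rw [map_compCoeff] at h5
  have h6 := map_compCoeff (Int.castRingHom ℚ) (fun j => p.getD j 0) J
  simp only [rescaledJet, Polynomial.coe_evalRingHom, Polynomial.eval_monomial, one_pow,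
    mul_one] at h5
  rw [h5]
  exact h6.symm

/-- The evaluation at the rescaled jet. -/
noncomputable def rescaledEval (k : ℕ) (p : List ℤ) : CoeffRing k →ₐ[ℚ] Polynomial ℚ :=
  MvPolynomial.aeval fun i => rescaledJet p i

/-- The value at the jet `p` of the part of weight `k - 1` of a polynomial. -/
noncomputable def jetFunctional (k : ℕ) (p : List ℤ) : CoeffRing k →ₗ[ℚ] ℚ :=
  Polynomial.lcoeff ℚ (k - 1) ∘ₗ (rescaledEval k p).toLinearMap

theorem jetFunctional_apply (k : ℕ) (p : List ℤ) (q : CoeffRing k) :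
    jetFunctional k p q = (rescaledEval k p q).coeff (k - 1) := rfl

theorem jetFunctional_monomial {k : ℕ} (p : List ℤ) {l : List ℕ}
    (hl : ∀ j ∈ l, 2 ≤ j ∧ j ≤ k) : jetFunctional k p (l.map (coeffVar k)).prod =
      if indexWeight l = k - 1 then ((monomialValue p l : ℤ) : ℚ) else 0 := by
  have h : rescaledEval k p (l.map (coeffVar k)).prod =
      Polynomial.monomial (indexWeight l) ((monomialValue p l : ℤ) : ℚ) := by
    induction l with
    | nil => simp [indexWeight, monomialValue]
    | cons j l ih =>
      have h1 : rescaledEval k p (coeffVar k j) = rescaledJet p j :=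
        aeval_coeffVar (rescaledJet p) (hl j (by simp))
      rw [List.map_cons, List.prod_cons, map_mul, ih fun i hi => hl i (by simp [hi]), h1,
        rescaledJet, Polynomial.monomial_mul_monomial]
      simp [indexWeight, monomialValue]
  rw [jetFunctional_apply, h, Polynomial.coeff_monomial]

theorem rescaledEval_stabPoly (p : List ℤ) {k j : ℕ} (hj : 2 ≤ j) (hjk : j ≤ k) :
    rescaledEval k p (stabPoly k j) =
      Polynomial.monomial (j - 1) ((compCoeff (fun j => p.getD j 0) j : ℤ) : ℚ) := by
  rw [← compCoeff_rescaledJet p hj]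
  exact map_stabPoly (rescaledEval k p).toRingHom
    (fun _ hi hik => aeval_coeffVar (rescaledJet p) ⟨hi, hik⟩) hjk

theorem jetFunctional_eq_zero_of_mem_stabIdeal {k : ℕ} {p : List ℤ}
    (hp : ∀ j, 3 ≤ j → j < k → compCoeff (fun j => p.getD j 0) j = 0) {q : CoeffRing k}
    (hq : q ∈ stabIdeal k) : jetFunctional k p q = 0 := by
  have hle : stabIdeal k ≤ RingHom.ker (rescaledEval k p).toRingHom := by
    refine Ideal.span_le.2 ?_
    rintro _ ⟨j, hj, hjk, rfl⟩
    refine (rescaledEval_stabPoly p (by omega) hjk.le).trans ?_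
    rw [hp j hj hjk, Int.cast_zero, map_zero]
  have h : rescaledEval k p q = 0 := hle hq
  rw [jetFunctional_apply, h, Polynomial.coeff_zero]

/-! ### Elimination of the coefficients of odd order -/

/-- The polynomials that are homogeneous of weight `w` and involve only the `a_j` of even order `j`
and `a_k`. -/
noncomputable def evenPart (k w : ℕ) : Submodule ℚ (CoeffRing k) :=
  Submodule.span ℚ {x | ∃ s : Multiset ℕ, (∀ j ∈ s, (2 ≤ j ∧ j ≤ k) ∧ (Even j ∨ j = k)) ∧
    (s.map (· - 1)).sum = w ∧ (s.map (coeffVar k)).prod = x}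

theorem one_mem_evenPart (k : ℕ) : (1 : CoeffRing k) ∈ evenPart k 0 :=
  Submodule.subset_span ⟨0, by simp, by simp, by simp⟩

theorem mul_mem_evenPart {k u v : ℕ} {x y : CoeffRing k} (hx : x ∈ evenPart k u)
    (hy : y ∈ evenPart k v) : x * y ∈ evenPart k (u + v) := by
  have h := Submodule.mul_mem_mul hx hy
  rw [evenPart, evenPart, Submodule.span_mul_span] at h
  refine Submodule.span_mono ?_ h
  rintro _ ⟨_, ⟨s, hs, rfl, rfl⟩, _, ⟨t, ht, rfl, rfl⟩, rfl⟩
  refine ⟨s + t, fun j hj => ?_, by simp, by simp⟩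
  exact (Multiset.mem_add.1 hj).elim (hs j) (ht j)

theorem coeffVar_mem_evenPart {k j : ℕ} (hj : 2 ≤ j ∧ j ≤ k) (h : Even j ∨ j = k) :
    coeffVar k j ∈ evenPart k (j - 1) :=
  Submodule.subset_span ⟨{j}, by simpa using ⟨hj, h⟩, by simp, by simp⟩

/-- The classes modulo `⟨W_3, …, W_{k-1}⟩` of the elements of `evenPart k w`. -/
noncomputable def evenClasses (k w : ℕ) : Submodule ℚ (CoeffRing k ⧸ stabIdeal k) :=
  (evenPart k w).map (Ideal.Quotient.mkₐ ℚ (stabIdeal k)).toLinearMap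

theorem one_mem_evenClasses (k : ℕ) : (1 : CoeffRing k ⧸ stabIdeal k) ∈ evenClasses k 0 :=
  ⟨1, one_mem_evenPart k, map_one (Ideal.Quotient.mkₐ ℚ (stabIdeal k))⟩

theorem mul_mem_evenClasses {k : ℕ} (u v : ℕ) (x : CoeffRing k ⧸ stabIdeal k)
    (hx : x ∈ evenClasses k u) (y : CoeffRing k ⧸ stabIdeal k) (hy : y ∈ evenClasses k v) :
    x * y ∈ evenClasses k (u + v) := by
  obtain ⟨x, hx, rfl⟩ := hx
  obtain ⟨y, hy, rfl⟩ := hy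
  exact ⟨x * y, mul_mem_evenPart hx hy, map_mul (Ideal.Quotient.mkₐ ℚ (stabIdeal k)) x y⟩

/-- For odd `j < k`, the relation `W_j = -2 a_j + ⋯` expresses `a_j` modulo the ideal by the earlier
coefficients. -/
theorem mk_coeffVar_mem_evenClasses {k j : ℕ} (hj : 2 ≤ j) (hjk : j ≤ k) :
    Ideal.Quotient.mk (stabIdeal k) (coeffVar k j) ∈ evenClasses k (j - 1) := by
  induction j using Nat.strong_induction_on with
  | _ j ih =>
    by_cases h : Even j ∨ j = k
    · exact ⟨_, coeffVar_mem_evenPart ⟨hj, hjk⟩ h, rfl⟩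
    · rw [not_or, Nat.not_even_iff_odd] at h
      have h3 : 3 ≤ j := by
        obtain ⟨m, rfl⟩ := h.1
        omega
      have h0 : compCoeff (fun i => Ideal.Quotient.mk (stabIdeal k) (coeffVar k i)) j = 0 := by
        rw [← map_compCoeff, ← stabPoly_eq, Ideal.Quotient.eq_zero_iff_mem]
        exact Ideal.subset_span ⟨j, h3, lt_of_le_of_ne hjk h.2, rfl⟩
      have h4 := compCoeff_add_mem_of_graded_of_odd (M := fun w => (evenClasses k w).toAddSubgroup)
        (one_mem_evenClasses k) mul_mem_evenClasses
        (fun i => Ideal.Quotient.mk (stabIdeal k) (coeffVar k i)) hj h.1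
        fun l hl hlj => ih l hlj hl (hlj.le.trans hjk)
      rw [h0, zero_add] at h4
      have h5 := (evenClasses k (j - 1)).smul_mem (2⁻¹ : ℚ) h4
      convert h5 using 1
      rw [← two_smul ℚ, smul_smul]
      norm_num

theorem mk_prod_mem_evenClasses {k : ℕ} {l : List ℕ} (hl : ∀ j ∈ l, 2 ≤ j ∧ j ≤ k) :
    Ideal.Quotient.mk (stabIdeal k) (l.map (coeffVar k)).prod ∈ evenClasses k (indexWeight l) := by
  induction l with
  | nil => simpa [indexWeight] using one_mem_evenClasses k
  | cons j l ih =>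
    rw [List.map_cons, List.prod_cons, map_mul, indexWeight, List.map_cons, List.sum_cons]
    have hj := hl j (by simp)
    exact mul_mem_evenClasses _ _ _ (mk_coeffVar_mem_evenClasses hj.1 hj.2) _
      (ih fun i hi => hl i (by simp [hi]))

theorem mk_stabPoly_mem_evenClasses {k : ℕ} (hk : 2 ≤ k) (hodd : Odd k) :
    Ideal.Quotient.mk (stabIdeal k) (stabPoly k k) ∈ evenClasses k (k - 1) := by
  have h := compCoeff_add_mem_of_graded_of_odd (M := fun w => (evenClasses k w).toAddSubgroup)
    (one_mem_evenClasses k) mul_mem_evenClasses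
    (fun i => Ideal.Quotient.mk (stabIdeal k) (coeffVar k i)) hk hodd
    fun l hl hlk => mk_coeffVar_mem_evenClasses hl hlk.le
  have hkk := mk_coeffVar_mem_evenClasses hk le_rfl
  rw [stabPoly_eq, map_compCoeff]
  have h2 := Submodule.sub_mem _ h (Submodule.add_mem _ hkk hkk)
  convert h2 using 1
  exact (add_sub_cancel_right _ _).symm

theorem evenPart_le_span {k : ℕ} (hk : 1 ≤ k) : evenPart k (k - 1) ≤
    Submodule.span ℚ {x | ∃ l ∈ evenMonomials k, (l.map (coeffVar k)).prod = x} := by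
  refine Submodule.span_mono ?_
  rintro _ ⟨s, hs, hw, rfl⟩
  refine ⟨s.sort (· ≥ ·), ?_, ?_⟩
  · have hmem : ∀ j ∈ s.sort (· ≥ ·), j ∈ s := fun j hj => (Multiset.mem_sort _).1 hj
    rw [evenMonomials, List.mem_filter, mem_weightMonomials hk]
    refine ⟨⟨?_, Multiset.pairwise_sort _ _, fun j hj => (hs j (hmem j hj)).1⟩, ?_⟩
    · rw [← hw, indexWeight, ← Multiset.sum_coe, ← Multiset.map_coe, Multiset.sort_eq]
    · rw [List.all_eq_true]
      intro j hj
      simpa [Nat.even_iff] using (hs j (hmem j hj)).2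
  · rw [← Multiset.prod_coe, ← Multiset.map_coe, Multiset.sort_eq]

end StabIdeal

/-! ### The listed formulas -/

section Certificates

open scoped MonomialOrder

/-- The polynomial in `a_2, …, a_k` with the given list of terms; a term consists of the numerator
and the denominator of the coefficient and of the indices of the monomial. -/
noncomputable def ofTerms (k : ℕ) (T : List (ℤ × ℕ × List ℕ)) : CoeffRing k :=
  (T.map fun t => ((t.1 : ℚ) / (t.2.1 : ℚ)) • (t.2.2.map (coeffVar k)).prod).sum

theorem involutionJets_spec : (involutionJets.all fun p => p.getD 0 0 == 0 && p.getD 1 0 == -1 &&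
    compTrunc 16 p p == 0 :: 1 :: List.replicate 14 0) = true := by
  decide +kernel

theorem compCoeff_involutionJet {p : List ℤ} (hp : p ∈ involutionJets) {j : ℕ} (hj : 3 ≤ j)
    (hj' : j ≤ 15) : compCoeff (fun i => p.getD i 0) j = 0 := by
  have h := List.all_eq_true.1 involutionJets_spec p hp
  simp only [Bool.and_eq_true, beq_iff_eq] at h
  obtain ⟨⟨h0, h1⟩, h2⟩ := h
  rw [← getD_compTrunc h0 h1 (show j < 16 by omega), h2]
  interval_cases j <;> rfl

theorem getD_replicate_append (k j : ℕ) :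
    (List.replicate k (0 : ℤ) ++ [1]).getD j 0 = if j = k then 1 else 0 := by
  rcases lt_trichotomy j k with h | rfl | h
  · rw [List.getD_append _ _ _ _ (by simpa using h), if_neg h.ne]
    simp
  · simp
  · rw [if_neg h.ne', List.getD_eq_default]
    simp
    omega

theorem jetFunctional_ofTerms {k : ℕ} (p : List ℤ) {T : List (ℤ × ℕ × List ℕ)}
    (hT : ∀ t ∈ T, indexWeight t.2.2 = k - 1 ∧ IsIndexList k t.2.2) {D : ℕ} (hD : D ≠ 0)
    (hdvd : ∀ t ∈ T, D % t.2.1 = 0) :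
    (D : ℚ) * jetFunctional k p (ofTerms k T) = (scaledValue D p T : ℤ) := by
  induction T with
  | nil => simp [ofTerms, scaledValue]
  | cons t T ih =>
    have h1 := ih (fun t ht => hT t (by simp [ht])) fun t ht => hdvd t (by simp [ht])
    obtain ⟨e, he⟩ := Nat.dvd_of_mod_eq_zero (hdvd t (by simp))
    have ht0 : t.2.1 ≠ 0 := fun h0 => hD (by rw [he, h0, zero_mul])
    have ht := hT t (by simp)
    simp only [ofTerms, scaledValue, List.map_cons, List.sum_cons, map_add, map_smul, smul_eq_mul,
      mul_add, Int.cast_add] at h1 ⊢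
    rw [h1, jetFunctional_monomial p ht.2.2, if_pos ht.1]
    congr 1
    have h2 : D / t.2.1 = e := by rw [he, Nat.mul_div_cancel_left _ (Nat.pos_of_ne_zero ht0)]
    rw [h2, he]
    have : (t.2.1 : ℚ) ≠ 0 := by exact_mod_cast ht0
    push_cast
    field_simp

theorem mk_ofTerms_mem_evenClasses {k : ℕ} {T : List (ℤ × ℕ × List ℕ)}
    (hT : ∀ t ∈ T, indexWeight t.2.2 = k - 1 ∧ IsIndexList k t.2.2) :
    Ideal.Quotient.mk (stabIdeal k) (ofTerms k T) ∈ evenClasses k (k - 1) := by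
  induction T with
  | nil => simp [ofTerms]
  | cons t T ih =>
    have ht := hT t (by simp)
    have h1 := mk_prod_mem_evenClasses ht.2.2
    rw [ht.1] at h1
    have h2 := ih fun t ht => hT t (by simp [ht])
    simp only [ofTerms, List.map_cons, List.sum_cons, map_add] at h2 ⊢
    refine Submodule.add_mem _ ?_ h2
    exact Submodule.smul_mem _ ((t.1 : ℚ) / (t.2.1 : ℚ)) h1

theorem exists_of_mem_support_ofTerms {k : ℕ} {T : List (ℤ × ℕ × List ℕ)}
    (hT : ∀ t ∈ T, ∀ j ∈ t.2.2, 2 ≤ j ∧ j ≤ k) {α : Finset.Icc 2 k →₀ ℕ}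
    (hα : α ∈ (ofTerms k T).support) : ∃ t ∈ T, α = indexExponent k t.2.2 := by
  classical
  induction T with
  | nil => simp [ofTerms] at hα
  | cons t T ih =>
    rw [ofTerms, List.map_cons, List.sum_cons] at hα
    rcases Finset.mem_union.1 (MvPolynomial.support_add hα) with hα | hα
    · refine ⟨t, by simp, ?_⟩
      rw [← monomial_indexExponent (hT t (by simp))] at hα
      simpa using MvPolynomial.support_monomial_subset (MvPolynomial.support_smul hα)
    · obtain ⟨t, ht, h⟩ := ih (fun t ht => hT t (by simp [ht])) hα
      exact ⟨t, by simp [ht], h⟩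

theorem map_jetFunctional {k : ℕ} (P : List (List ℤ)) {l : List ℕ}
    (hl : indexWeight l = k - 1 ∧ IsIndexList k l) :
    (P.map (jetFunctional k)).map (fun φ => φ (l.map (coeffVar k)).prod) =
      (monomialValues P l).map fun y : ℤ => (y : ℚ) := by
  simp only [monomialValues, List.map_map]
  refine List.map_congr_left fun p _ => ?_
  simp only [Function.comp_apply]
  rw [jetFunctional_monomial p hl.2.2, if_pos hl.1]

theorem pairing_eq_zero {V : Type*} [AddCommGroup V] [Module ℚ V] {Φ : List (V →ₗ[ℚ] ℚ)} {y : V}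
    (h : ∀ φ ∈ Φ, φ y = 0) (c : List ℤ) : pairing c Φ y = 0 := by
  have h1 : Φ.map (fun φ => φ y) = (List.replicate Φ.length (0 : ℤ)).map fun y : ℤ => (y : ℚ) := by
    rw [List.map_replicate, Int.cast_zero, List.eq_replicate_iff]
    simpa using h
  rw [pairing_apply c h1]
  have h2 : ∀ (c : List ℤ) (n : ℕ), dotProd c (List.replicate n 0) = 0 := by
    intro c
    induction c with
    | nil => intro n; cases n <;> rfl
    | cons x c ih =>
      intro n
      cases n with
      | zero => rfl
      | succ n => simp [List.replicate_succ, dotProd, ih n]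
  rw [h2, Int.cast_zero]

/-- A monomial whose class is not a combination of the classes of smaller monomials of the same
weight, as seen by jets at which the ideal vanishes, is not a leading monomial. -/
theorem coeff_eq_zero_of_mem_independentLabels {k : ℕ} (hk : 1 ≤ k) {P : List (List ℤ)}
    (hP : ∀ q ∈ stabIdeal k, ∀ p ∈ P, jetFunctional k p q = 0)
    (hchain : (weightMonomials k).IsChain fun l m => precedes l m = true) {K : List (List ℤ)}
    {l : List ℕ} (hl : l ∈ independentLabels (monomialValues P) K (weightMonomials k))
    {q : CoeffRing k} (hq : q ∈ stabIdeal k)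
    (hle : ∀ β ∈ q.support, β ≼[grevlex (Finset.Icc 2 k)] indexExponent k l) :
    q.coeff (indexExponent k l) = 0 := by
  have hmem := fun l => mem_weightMonomials hk (l := l)
  have hpair : (weightMonomials k).Pairwise fun l m =>
      indexExponent k l ≺[grevlex (Finset.Icc 2 k)] indexExponent k m := by
    have htrans : IsTrans (List ℕ) fun l m =>
        indexExponent k l ≺[grevlex (Finset.Icc 2 k)] indexExponent k m :=
      ⟨fun _ _ _ h h' => lt_trans h h'⟩
    refine List.isChain_iff_pairwise.1 (hchain.imp_of_mem_imp ?_)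
    intro l m hl hm h
    exact indexExponent_lt_of_precedes ((hmem l).1 hl).2 ((hmem m).1 hm).2 h
  obtain ⟨ψ, h1, h2, h3⟩ := exists_functional_of_mem_independentLabels
    (b := fun l => (l.map (coeffVar k)).prod) (Φ := P.map (jetFunctional k))
    (fun l hl => map_jetFunctional P ((hmem l).1 hl)) hpair K hl
  have hlw := (hmem l).1 (mem_of_mem_independentLabels hl)
  have hq0 : ψ q = 0 := h2 q fun c _ => pairing_eq_zero (by simpa using hP q hq) c
  have hterm : ∀ β ∈ q.support, β ≠ indexExponent k l →
      ψ (MvPolynomial.monomial β (q.coeff β)) = 0 := by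
    intro β hβ hne
    obtain ⟨m, hm, rfl⟩ := exists_indexExponent_eq β
    have hsm : MvPolynomial.monomial (indexExponent k m) (q.coeff (indexExponent k m)) =
        q.coeff (indexExponent k m) • (m.map (coeffVar k)).prod := by
      rw [← monomial_indexExponent hm.2, MvPolynomial.smul_monomial, smul_eq_mul, mul_one]
    have hz : ψ (m.map (coeffVar k)).prod = 0 := by
      by_cases hw : indexWeight m = k - 1
      · refine h3 m ((hmem m).2 ⟨hw, hm⟩) (hle _ hβ).not_gt ?_
        rintro rfl
        exact hne rfl
      · refine h2 _ fun c _ => pairing_eq_zero ?_ c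
        intro φ hφ
        obtain ⟨p, -, rfl⟩ := List.mem_map.1 hφ
        rw [jetFunctional_monomial p hm.2, if_neg hw]
    rw [hsm, map_smul, hz, smul_zero]
  by_contra hne
  rw [q.as_sum, map_sum, Finset.sum_eq_single_of_mem _ (MvPolynomial.mem_support_iff.2 hne)
    hterm, show MvPolynomial.monomial (indexExponent k l) (q.coeff (indexExponent k l)) =
      q.coeff (indexExponent k l) • (l.map (coeffVar k)).prod by
        rw [← monomial_indexExponent hlw.2.2, MvPolynomial.smul_monomial, smul_eq_mul, mul_one],
    map_smul, smul_eq_mul, mul_eq_zero] at hq0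
  exact hq0.elim hne h1

theorem isReducedStabilityConstant_of_isCertificate {k : ℕ} (hk : 3 ≤ k) (hk' : k ≤ 15)
    (hodd : Odd k) {T : List (ℤ × ℕ × List ℕ)} (h : isCertificate k T = true) :
    IsReducedStabilityConstant k (ofTerms k T) := by
  simp only [isCertificate, Bool.and_eq_true, decide_eq_true_eq, beq_iff_eq, bne_iff_ne, ne_eq,
    List.all_eq_true] at h
  obtain ⟨⟨⟨⟨⟨⟨hchain, heven⟩, hstd⟩, hD⟩, hdvd⟩, hval⟩, hvals⟩ := h
  set P := testJets k T.length with hPdef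
  have hmem := fun l => mem_weightMonomials (show 1 ≤ k by omega) (l := l)
  have hTmem : ∀ t ∈ T, t.2.2 ∈ independentLabels (monomialValues P) (coordinates T.length)
      (weightMonomials k) := fun t ht => by
    rw [hstd]
    exact List.mem_map.2 ⟨t, ht, rfl⟩
  have hTw : ∀ t ∈ T, indexWeight t.2.2 = k - 1 ∧ IsIndexList k t.2.2 := fun t ht =>
    (hmem _).1 (mem_of_mem_independentLabels (hTmem t ht))
  -- the ideal vanishes at the test jets, and so does the difference of the two polynomials
  have hbasic : ∀ J, 2 ≤ J → J ≤ k → compCoeff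
      (fun i => (List.replicate k (0 : ℤ) ++ [1]).getD i 0) J = if J = k then -2 else 0 := by
    intro J hJ hJk
    rw [compCoeff_of_forall_eq_zero hJ fun l _ hlJ => by
      rw [getD_replicate_append, if_neg (by omega)], getD_replicate_append]
    split_ifs with hJ'
    · rw [hJ', hodd.neg_one_pow]; norm_num
    · ring
  have hP : ∀ q ∈ stabIdeal k, ∀ p ∈ P, jetFunctional k p q = 0 := by
    intro q hq p hp
    refine jetFunctional_eq_zero_of_mem_stabIdeal (fun j hj hjk => ?_) hq
    rcases List.mem_cons.1 hp with rfl | hp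
    · rw [hbasic j (by omega) hjk.le, if_neg hjk.ne]
    · exact compCoeff_involutionJet (List.mem_of_mem_take hp) hj (by omega)
  have hdiff : ∀ p ∈ P, jetFunctional k p (stabPoly k k - ofTerms k T) = 0 := by
    intro p hp
    have h1 := jetFunctional_ofTerms p hTw hD hdvd
    have hD' : (denominator T : ℚ) ≠ 0 := by exact_mod_cast hD
    rw [map_sub, jetFunctional_apply, rescaledEval_stabPoly p (by omega) le_rfl,
      Polynomial.coeff_monomial, if_pos rfl]
    refine (mul_eq_zero.1 (?_ : (denominator T : ℚ) * _ = 0)).resolve_left hD'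
    rw [mul_sub, h1]
    rcases List.mem_cons.1 hp with rfl | hp
    · rw [hval, hbasic k (by omega) le_rfl, if_pos rfl]
      push_cast
      ring
    · rw [hvals p hp, compCoeff_involutionJet (List.mem_of_mem_take hp) hk hk']
      simp
  refine isNormalForm_of_forall_coeff_eq_zero ?_ ?_
  · -- modulo the ideal the difference is a combination of even monomials, on which the test jets
    -- are injective
    obtain ⟨y, hy, hyq⟩ : Ideal.Quotient.mk (stabIdeal k) (stabPoly k k - ofTerms k T) ∈
        evenClasses k (k - 1) := by
      rw [map_sub]
      refine Submodule.sub_mem _ (mk_stabPoly_mem_evenClasses (by omega) hodd) ?_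
      exact mk_ofTerms_mem_evenClasses hTw
    have hyI : (stabPoly k k - ofTerms k T) - y ∈ stabIdeal k :=
      Ideal.Quotient.eq.1 hyq.symm
    have hev : ∀ l ∈ evenMonomials k,
        (P.map (jetFunctional k)).map (fun φ => φ (l.map (coeffVar k)).prod) =
          (monomialValues P l).map fun y : ℤ => (y : ℚ) := fun l hl =>
      map_jetFunctional P ((hmem l).1 (List.mem_filter.1 hl).1)
    have hy0 : y = 0 := by
      refine eq_zero_of_independentLabels_eq_self hev (coordinates T.length) heven
        (evenPart_le_span (by omega) hy) fun c _ => pairing_eq_zero (fun φ hφ => ?_) c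
      obtain ⟨p, hp, rfl⟩ := List.mem_map.1 hφ
      have h1 := hP _ hyI p hp
      rw [map_sub, hdiff p hp, zero_sub, neg_eq_zero] at h1
      exact h1
    rwa [hy0, sub_zero] at hyI
  · intro α hα q hq hle
    obtain ⟨t, ht, rfl⟩ := exists_of_mem_support_ofTerms (fun t ht => (hTw t ht).2.2) hα
    exact coeff_eq_zero_of_mem_independentLabels (by omega) hP hchain (hTmem t ht) hq hle

end Certificates

/-! ### The reduced constants and the stability of the origin -/

theorem isCertificate_terms3 : isCertificate 3 terms3 = true := by decide +kernel

theorem isCertificate_terms5 : isCertificate 5 terms5 = true := by decide +kernel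

theorem isCertificate_terms7 : isCertificate 7 terms7 = true := by decide +kernel

theorem isCertificate_terms9 : isCertificate 9 terms9 = true := by decide +kernel

theorem isCertificate_terms11 : isCertificate 11 terms11 = true := by decide +kernel

theorem isCertificate_terms13 : isCertificate 13 terms13 = true := by decide +kernel

theorem isCertificate_terms15 : isCertificate 15 terms15 = true := by decide +kernel

theorem ofTerms_terms3 : ofTerms 3 terms3 = explicitV3 (coeffVar 3) := by
  generalize ha : coeffVar 3 = a
  simp only [ofTerms, terms3, explicitV3, ha, List.map_cons, List.map_nil, List.sum_cons,
    List.sum_nil, List.prod_cons, List.prod_nil, mul_one, pow_two]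
  push_cast
  module

theorem ofTerms_terms5 : ofTerms 5 terms5 = explicitV5 (coeffVar 5) := by
  generalize ha : coeffVar 5 = a
  simp only [ofTerms, terms5, explicitV5, ha, List.map_cons, List.map_nil, List.sum_cons,
    List.sum_nil, List.prod_cons, List.prod_nil, mul_one, pow_two, mul_comm]
  push_cast
  module

theorem ofTerms_terms7 : ofTerms 7 terms7 = explicitV7 (coeffVar 7) := by
  generalize ha : coeffVar 7 = a
  simp only [ofTerms, terms7, explicitV7, ha, List.map_cons, List.map_nil, List.sum_cons,
    List.sum_nil, List.prod_cons, List.prod_nil, mul_one, pow_two, mul_comm, mul_left_comm]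
  push_cast
  module

theorem ofTerms_terms9 : ofTerms 9 terms9 = explicitV9 (coeffVar 9) := by
  generalize ha : coeffVar 9 = a
  simp only [ofTerms, terms9, explicitV9, ha, List.map_cons, List.map_nil, List.sum_cons,
    List.sum_nil, List.prod_cons, List.prod_nil, mul_one, pow_two, mul_comm, mul_left_comm]
  push_cast
  module

theorem ofTerms_terms11 : ofTerms 11 terms11 = explicitV11 (coeffVar 11) := by
  generalize ha : coeffVar 11 = a
  simp only [ofTerms, terms11, explicitV11, ha, List.map_cons, List.map_nil, List.sum_cons,
    List.sum_nil, List.prod_cons, List.prod_nil, mul_one, pow_two, mul_comm, mul_left_comm]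
  push_cast
  module

theorem ofTerms_terms13 : ofTerms 13 terms13 = explicitV13 (coeffVar 13) := by
  generalize ha : coeffVar 13 = a
  simp only [ofTerms, terms13, explicitV13, ha, List.map_cons, List.map_nil, List.sum_cons,
    List.sum_nil, List.prod_cons, List.prod_nil, mul_one, pow_two, mul_comm, mul_left_comm]
  push_cast
  module

theorem ofTerms_terms15 : ofTerms 15 terms15 = explicitV15 (coeffVar 15) := by
  generalize ha : coeffVar 15 = a
  simp only [ofTerms, terms15, explicitV15, ha, List.map_cons, List.map_nil, List.sum_cons,
    List.sum_nil, List.prod_cons, List.prod_nil, mul_one, pow_two, mul_comm, mul_left_comm]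
  push_cast
  module

theorem isReducedStabilityConstant_iff {k : ℕ} {V : CoeffRing k}
    (hV : IsReducedStabilityConstant k V) (P : CoeffRing k) :
    IsReducedStabilityConstant k P ↔ P = V :=
  ⟨fun hP => IsNormalForm.unique hP hV, fun h => h ▸ hV⟩

theorem IsReducedStabilityConstant.isStabilityConstant {k : ℕ} {V : CoeffRing k}
    (hV : IsReducedStabilityConstant k V) : IsStabilityConstant k V := by
  obtain ⟨G, -, h, -⟩ := hV
  rw [IsStabilityConstant, ← neg_sub]
  exact neg_mem h

theorem evalAt_of_isStabilityConstant {a : ℕ → ℝ} {k : ℕ}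
    (h : ∀ j, 3 ≤ j → j < k → compCoeff a j = 0) {V : CoeffRing k}
    (hV : IsStabilityConstant k V) : evalAt a V = compCoeff a k := by
  have h1 := evalAt_eq_zero_of_mem_stabIdeal h hV
  rw [← evalAt_stabPoly a le_rfl]
  rw [evalAt, map_sub, sub_eq_zero] at h1
  exact h1

/-- A map that is not an involution has a first nonzero stability constant; its order is odd, its
value does not depend on the choice of the constants, and its sign decides the stability. -/
theorem exists_first_stabilityConstant {f : ℝ → ℝ} {a : ℕ → ℝ}
    (hf : ∀ᶠ x in 𝓝 (0 : ℝ), HasSum (fun j : ℕ => a (j + 2) * x ^ (j + 2)) (f x + x))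
    (hinv : ¬ ∀ᶠ x in 𝓝 (0 : ℝ), f (f x) = x) :
    ∃ m : ℕ, 1 ≤ m ∧
      ∀ U : ∀ k : ℕ, CoeffRing k, (∀ k, 3 ≤ k → IsStabilityConstant k (U k)) →
        (∀ j, 3 ≤ j → j ≤ 2 * m → evalAt a (U j) = 0) ∧
        evalAt a (U (2 * m + 1)) ≠ 0 ∧
        (evalAt a (U (2 * m + 1)) < 0 → IsLocallyAsymptoticallyStable f) ∧
        (0 < evalAt a (U (2 * m + 1)) → IsRepeller f) := by
  have hne : ∃ n, 3 ≤ n ∧ compCoeff a n ≠ 0 := by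
    by_contra! h
    refine hinv ?_
    filter_upwards [hasSum_comp_self hf] with x hx
    have h0 : (fun j : ℕ => compCoeff a (j + 3) * x ^ (j + 3)) = fun _ => 0 :=
      funext fun j => by rw [h _ (by omega), zero_mul]
    rw [h0] at hx
    exact sub_eq_zero.1 (hx.unique hasSum_zero)
  classical
  obtain ⟨hn3, hn⟩ := Nat.find_spec hne
  have hmin : ∀ j, 3 ≤ j → j < Nat.find hne → compCoeff a j = 0 := fun j hj hjn => by
    by_contra h
    exact Nat.find_min hne hjn ⟨hj, h⟩
  set n := Nat.find hne
  have hexp := hasExpansion_of_hasSum (hasSum_jet hf)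
  have hodd : Odd n := Nat.not_even_iff_odd.1 fun hev =>
    hn (compCoeff_eq_zero_of_even (analyticAt_of_hasSum hf) hexp hn3 hev hmin)
  have hstab := stability_of_compCoeff hexp hn3 hodd hmin
  obtain ⟨m, hm⟩ := hodd
  refine ⟨m, by omega, fun U hU => ⟨fun j hj hjm => ?_, ?_⟩⟩
  · rw [evalAt_of_isStabilityConstant (fun i hi hij => hmin i hi (by omega)) (hU j hj)]
    exact hmin j hj (by omega)
  · rw [evalAt_of_isStabilityConstant (fun i hi hij => hmin i hi (by omega))
      (hU (2 * m + 1) (by omega)), ← hm]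
    exact ⟨hn, hstab⟩

theorem theorem2 :
    ∃ V : ∀ k : ℕ, CoeffRing k,
      -- the reduced stability constants exist, are unique, and are called `V k`
      (∀ k, 3 ≤ k → ∀ P : CoeffRing k, IsReducedStabilityConstant k P ↔ P = V k) ∧
      -- the first ones of odd order
      V 3 = explicitV3 (coeffVar 3) ∧ V 5 = explicitV5 (coeffVar 5) ∧
      V 7 = explicitV7 (coeffVar 7) ∧ V 9 = explicitV9 (coeffVar 9) ∧
      V 11 = explicitV11 (coeffVar 11) ∧ V 13 = explicitV13 (coeffVar 13) ∧
      V 15 = explicitV15 (coeffVar 15) ∧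
      -- every analytic map `f x = -x + ∑ a_j x ^ j` near the origin
      ∀ (f : ℝ → ℝ) (a : ℕ → ℝ),
        (∀ᶠ x in 𝓝 (0 : ℝ), HasSum (fun j : ℕ => a (j + 2) * x ^ (j + 2)) (f x + x)) →
        -- the polynomials `W_j` give the Taylor expansion of `f ∘ f`
        (∀ᶠ x in 𝓝 (0 : ℝ),
          HasSum (fun j : ℕ => evalAt a (stabPoly (j + 3) (j + 3)) * x ^ (j + 3)) (f (f x) - x)) ∧
        -- if `f` is not an involution, the first nonzero stability constant has odd order, and its
        -- sign gives the stability of the origin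
        (¬ (∀ᶠ x in 𝓝 (0 : ℝ), f (f x) = x) →
          ∃ m : ℕ, 1 ≤ m ∧
            -- for the reduced constants
            ((∀ j, 3 ≤ j → j ≤ 2 * m → evalAt a (V j) = 0) ∧
              evalAt a (V (2 * m + 1)) ≠ 0 ∧
              (evalAt a (V (2 * m + 1)) < 0 → IsLocallyAsymptoticallyStable f) ∧
              (0 < evalAt a (V (2 * m + 1)) → IsRepeller f)) ∧
            -- for any expressions of the stability constants, in particular for the `W_j`
            ∀ U : ∀ k : ℕ, CoeffRing k, (∀ k, 3 ≤ k → IsStabilityConstant k (U k)) →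
              (∀ j, 3 ≤ j → j ≤ 2 * m → evalAt a (U j) = 0) ∧
              evalAt a (U (2 * m + 1)) ≠ 0 ∧
              (evalAt a (U (2 * m + 1)) < 0 → IsLocallyAsymptoticallyStable f) ∧
              (0 < evalAt a (U (2 * m + 1)) → IsRepeller f)) := by
  choose V hV using fun k => exists_isNormalForm (grevlex (Finset.Icc 2 k)) (stabIdeal k)
    (stabPoly k k)
  have hcert : ∀ {k : ℕ} {T : List (ℤ × ℕ × List ℕ)} {P : CoeffRing k}, 3 ≤ k → k ≤ 15 → Odd k →
      isCertificate k T = true → ofTerms k T = P → V k = P := fun hk hk' hodd hT hP =>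
    (((isReducedStabilityConstant_iff (hV _) _).1
      (isReducedStabilityConstant_of_isCertificate hk hk' hodd hT)).symm.trans hP)
  refine ⟨V, fun k _ => isReducedStabilityConstant_iff (hV k),
    hcert (by norm_num) (by norm_num) (by decide) isCertificate_terms3 ofTerms_terms3,
    hcert (by norm_num) (by norm_num) (by decide) isCertificate_terms5 ofTerms_terms5,
    hcert (by norm_num) (by norm_num) (by decide) isCertificate_terms7 ofTerms_terms7,
    hcert (by norm_num) (by norm_num) (by decide) isCertificate_terms9 ofTerms_terms9,
    hcert (by norm_num) (by norm_num) (by decide) isCertificate_terms11 ofTerms_terms11,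
    hcert (by norm_num) (by norm_num) (by decide) isCertificate_terms13 ofTerms_terms13,
    hcert (by norm_num) (by norm_num) (by decide) isCertificate_terms15 ofTerms_terms15,
    fun f a hf => ⟨?_, fun hinv => ?_⟩⟩
  · simpa only [evalAt_stabPoly a le_rfl] using hasSum_comp_self hf
  · obtain ⟨m, hm, H⟩ := exists_first_stabilityConstant hf hinv
    exact ⟨m, hm, H V fun k _ => IsReducedStabilityConstant.isStabilityConstant (hV k), H⟩
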